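/- Let $\mathcal H$ be a complex Hilbert space, $\hbar>0$, and $U(t)=e^{-it\hat H/\hbar}$ a strongly continuous one-parameter unitary group on $\mathcal H$ with Hamiltonian $\hat H$ (so $\hat Hx=i\hbar\frac{d}{dt}U(t)x|_{t=0}$ on the domain $D(\hat H)$ of all $x$ for which the derivative exists). States may be generalized vectors of the rigging $D(\hat H)\subset\mathcal H\subset D(\hat H)^\times$: a generalized vector $\psi$ is an antilinear functional $\varphi\mapsto\langle\varphi|\psi\rangle$ on $D(\hat H)$ that is continuous for the graph norm, and its evolution is $\psi(t)=U(t)\psi$, i.e. $\langle\varphi|\psi(t)\rangle=\langle U(-t)\varphi|\psi\rangle$. The integrals $\int_a^b\psi(t)\,dt$, taken weakly, are vectors of $\mathcal H$. Two generalized states $\chi,\xi$ are called perfectly distinguishable (orthogonal) if $\langle\chi_\varepsilon,\xi_\varepsilon\rangle\to0$ as $\varepsilon\to0^+$, where $\chi_\varepsilon=\frac1\varepsilon\int_0^\varepsilon U(s)\chi\,ds$ and $\xi_\varepsilon=\frac1\varepsilon\int_0^\varepsilon U(s)\xi\,ds$; for vectors of $\mathcal H$ this means $\langle\chi,\xi\rangle=0$.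 Let $\psi\neq0$ be a generalized state such that $\psi(0)$ is perfectly distinguishable from $\psi(t)$ for all $t<0$, or for all $t>0$. Let $\mathcal V\subset\mathcal H$ be the closed linear span of its history, i.e. of the vectors $\int_a^b\psi(t)\,dt$, $a,b\in\mathbb R$. Then $U(t)\mathcal V\subset\mathcal V$ for all $t$, $\hat H$ maps $D(\hat H)\cap\mathcal V$ into $\mathcal V$, and there are a unitary map $W:\mathcal V\to L^2(\mathbb R,\mathbb C)$, a constant $c>0$, and an operator $\hat\tau$ in $\mathcal V$ such that: 1. for every $\varphi\in\mathcal V\cap D(\hat H)$, $(W\varphi)(\tau)=c\,\overline{\langle\varphi|\psi(\tau)\rangle}$ for almost every $\tau$; 2. $W$ carries $\hat H|_{\mathcal V}$ to $-i\hbar\frac{\partial}{\partial\tau}$ with domain the Sobolev space $H^1(\mathbb R)$, and $\hat\tau$ to multiplication by $\tau$ on its maximal domain; 3. $\hat\tau$ is a canonical conjugate of $\hat H|_{\mathcal V}$: both operators are self-adjoint, the domain $D(\hat\tau\hat H|_{\mathcal V})\cap D(\hat H|_{\mathcal V}\hat\tau)$ is dense in $\mathcal V$ and $[\hat\tau,\hat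 H]=i\hbar$ on it, and the Weyl relations $e^{-i\alpha\hat\tau/\hbar}\,e^{-it\hat H/\hbar}=e^{-i\alpha t/\hbar}\,e^{-it\hat H/\hbar}\,e^{-i\alpha\hat\tau/\hbar}$ hold on $\mathcal V$ for all $\alpha,t\in\mathbb R$; 4. for every $\tau\in\mathbb R$, $\psi(\tau)$ is a generalized eigenvector of $\hat\tau$ with eigenvalue $\tau$: $\langle\hat\tau\varphi|\psi(\tau)\rangle=\tau\langle\varphi|\psi(\tau)\rangle$ for all $\varphi\in D(\hat\tau)\cap D(\hat H)$ with $\hat\tau\varphi\in D(\hat H)$, and $\langle\varphi|\psi(\tau)\rangle\neq0$ for some such $\varphi$. In this sense $\hat\tau$ is a time operator. -/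

import Mathlib

open MeasureTheory Filter Topology
open scoped ContDiff InnerProductSpace

noncomputable section

namespace TimeOp

section Evolution

variable {H : Type*} [NormedAddCommGroup H] [InnerProductSpace ℂ H]

/-- A strongly continuous one-parameter group of unitary operators. -/
structure UnitaryGroup (H : Type*) [NormedAddCommGroup H] [InnerProductSpace ℂ H] where
  op : ℝ → (H ≃ₗᵢ[ℂ] H)
  op_add : ∀ s t x, op (s + t) x = op s (op t x)
  continuous_op : ∀ x, Continuous fun t => op t x

/-- The Hamiltonian of the evolution `U`, i.e. the operator with `U t = exp (-i t Ĥ / ħ)`: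
it is `iħ d/dt (U t x)` at `t = 0`, on the domain of all `x` for which this derivative exists. -/
def UnitaryGroup.hamiltonian (U : UnitaryGroup H) (ħ : ℝ) : H →ₗ.[ℂ] H where
  domain :=
    { carrier := {x | DifferentiableAt ℝ (fun t => U.op t x) 0}
      zero_mem' := by simp
      add_mem' := by
        intro x y hx hy
        simpa only [Set.mem_ofPred_eq, map_add] using DifferentiableAt.fun_add hx hy
      smul_mem' := by
        intro c x hx
        simpa only [Set.mem_ofPred_eq, map_smul] using DifferentiableAt.fun_const_smul hx c }
  toFun :=
    { toFun := fun x => (Complex.I * ħ) • deriv (fun t => U.op t (x : H)) 0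
      map_add' := by
        intro x y
        have h := deriv_fun_add x.2 y.2
        simp only [Submodule.coe_add, map_add]
        rw [h, smul_add]
      map_smul' := by
        intro c x
        have h := deriv_fun_const_smul c x.2
        simp only [Submodule.coe_smul, map_smul, RingHom.id_apply]
        rw [h, smul_comm] }

theorem UnitaryGroup.op_comm (U : UnitaryGroup H) (s t : ℝ) (x : H) :
    U.op s (U.op t x) = U.op t (U.op s x) := by
  rw [← U.op_add, ← U.op_add, add_comm]

/-- The domain of the Hamiltonian is invariant under the evolution. -/
theorem UnitaryGroup.op_mem_domain (U : UnitaryGroup H) (ħ t : ℝ) {x : H}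
    (hx : x ∈ (U.hamiltonian ħ).domain) : U.op t x ∈ (U.hamiltonian ħ).domain := by
  have h : DifferentiableAt ℝ (fun s => U.op t (U.op s x)) 0 :=
    ((U.op t).toContinuousLinearEquiv.toContinuousLinearMap.restrictScalars
      ℝ).differentiableAt.comp (0 : ℝ) hx
  change DifferentiableAt ℝ (fun s => U.op s (U.op t x)) 0
  simpa only [U.op_comm _ t] using h

/-- The Hamiltonian commutes with the evolution. -/
theorem UnitaryGroup.hamiltonian_op (U : UnitaryGroup H) (ħ t : ℝ)
    (x : (U.hamiltonian ħ).domain) :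
    U.hamiltonian ħ ⟨U.op t x, U.op_mem_domain ħ t x.2⟩ = U.op t (U.hamiltonian ħ x) := by
  have hx : DifferentiableAt ℝ (fun s => U.op s (x : H)) 0 := x.2
  have h : HasDerivAt (fun s => U.op t (U.op s (x : H)))
      (U.op t (deriv (fun s => U.op s (x : H)) 0)) 0 :=
    ((U.op t).toContinuousLinearEquiv.toContinuousLinearMap.restrictScalars
      ℝ).hasFDerivAt.comp_hasDerivAt (0 : ℝ) hx.hasDerivAt
  change (Complex.I * ħ) • deriv (fun s => U.op s (U.op t (x : H))) 0
    = U.op t ((Complex.I * ħ) • deriv (fun s => U.op s (x : H)) 0)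
  simp only [U.op_comm _ t]
  rw [h.deriv, map_smul]

end Evolution

section Rigging

variable {H : Type*} [NormedAddCommGroup H] [InnerProductSpace ℂ H]

/-- The generalized vectors of the rigging `D(A) ⊆ H ⊆ D(A)ˣ` that belongs to an operator `A`:
continuous antilinear functionals `φ ↦ ⟨φ|ψ⟩` on the domain of `A` with its graph norm.
A vector `v` of `H` is the functional `φ ↦ ⟪φ, v⟫`. -/
structure GeneralizedVector (A : H →ₗ.[ℂ] H) where
  /-- The pairing `φ ↦ ⟨φ|ψ⟩`. -/
  pair : A.domain →ₗ⋆[ℂ] ℂ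
  bounded : ∃ C : ℝ, ∀ φ : A.domain, ‖pair φ‖ ≤ C * (‖(φ : H)‖ + ‖A φ‖)

/-- The state `ψ(t) = U(t) ψ` at time `t`, for a generalized initial state `ψ = ψ(0)`:
`⟨φ|ψ(t)⟩ = ⟨U(-t) φ|ψ⟩`. -/
def UnitaryGroup.evolve (U : UnitaryGroup H) (ħ : ℝ)
    (ψ : GeneralizedVector (U.hamiltonian ħ)) (t : ℝ) :
    GeneralizedVector (U.hamiltonian ħ) where
  pair :=
    { toFun := fun φ => ψ.pair ⟨U.op (-t) φ, U.op_mem_domain ħ (-t) φ.2⟩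
      map_add' := by
        intro x y
        rw [← map_add]
        congr 1
        ext
        simp
      map_smul' := by
        intro c x
        rw [← map_smulₛₗ]
        congr 1
        ext
        simp }
  bounded := by
    obtain ⟨C, hC⟩ := ψ.bounded
    refine ⟨C, fun φ => ?_⟩
    have h := hC ⟨U.op (-t) φ, U.op_mem_domain ħ (-t) φ.2⟩
    rw [U.hamiltonian_op ħ (-t) φ, LinearIsometryEquiv.norm_map] at h
    simpa using h

/-- The vector `v` of `H` is the integral of `ψ(t)` over `a ≤ t ≤ b`, in the weak sense. -/
def IsHistoryIntegral (U : UnitaryGroup H) (ħ : ℝ) (ψ : GeneralizedVector (U.hamiltonian ħ))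
    (a b : ℝ) (v : H) : Prop :=
  ∀ φ : (U.hamiltonian ħ).domain, ⟪(φ : H), v⟫_ℂ = ∫ t in a..b, (U.evolve ħ ψ t).pair φ

/-- Orthogonality (perfect distinguishability) of two possibly generalized states `χ` and `ξ`:
with the averages `χ_ε = ε⁻¹ ∫_0^ε χ(s) ds` and `ξ_ε = ε⁻¹ ∫_0^ε ξ(s) ds`, which exist as vectors
of `H` and are unique, `⟪χ_ε, ξ_ε⟫` tends to `0` as `ε → 0+`. If `χ` and `ξ` are vectors of `H`,
then `χ_ε → χ` and `ξ_ε → ξ`, so that this says `⟪χ, ξ⟫ = 0`. -/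
def Distinguishable (U : UnitaryGroup H) (ħ : ℝ)
    (χ ξ : GeneralizedVector (U.hamiltonian ħ)) : Prop :=
  ∃ x y : ℝ → H,
    (∀ ε > 0, IsHistoryIntegral U ħ χ 0 ε (x ε) ∧ IsHistoryIntegral U ħ ξ 0 ε (y ε)) ∧
    Tendsto (fun ε : ℝ => ⟪(ε : ℂ)⁻¹ • x ε, (ε : ℂ)⁻¹ • y ε⟫_ℂ) (𝓝[>] 0) (𝓝 0)

/-- The history space: the closed linear span in `H` of the states `ψ(t)`, `t ∈ ℝ`, where a
generalized state enters through its integrals over bounded time intervals. -/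
def historySpace (U : UnitaryGroup H) (ħ : ℝ) (ψ : GeneralizedVector (U.hamiltonian ħ)) :
    Submodule ℂ H :=
  (Submodule.span ℂ {v | ∃ a b, IsHistoryIntegral U ħ ψ a b v}).topologicalClosure

instance historySpace_complete [CompleteSpace H] (U : UnitaryGroup H) (ħ : ℝ)
    (ψ : GeneralizedVector (U.hamiltonian ħ)) : CompleteSpace (historySpace U ħ ψ) :=
  Submodule.topologicalClosure.completeSpace _

end Rigging

section Operators

variable {H : Type*} [NormedAddCommGroup H] [InnerProductSpace ℂ H]

/-- The restriction of an operator `A` of `H` to a subspace `V`, as an operator of `V`: its graph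
consists of the pairs of vectors of `V` in the graph of `A`. -/
def restrictTo (A : H →ₗ.[ℂ] H) (V : Submodule ℂ H) : V →ₗ.[ℂ] V :=
  (A.graph.comap (V.subtype.prodMap V.subtype)).toLinearPMap

theorem mem_graph_restrictTo (A : H →ₗ.[ℂ] H) (V : Submodule ℂ H) (x y : V) :
    (x, y) ∈ (restrictTo A V).graph ↔ ((x : H), (y : H)) ∈ A.graph := by
  unfold restrictTo
  rw [Submodule.toLinearPMap_graph_eq]
  · simp
  · rintro ⟨u, v⟩ h hu
    have h' : ((u : H), (v : H)) ∈ A.graph := by simpa using h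
    have hu' : u = 0 := hu
    ext
    exact A.graph_fst_eq_zero_snd h' (by simp [hu'])

/-- The Hilbert space `L²(ℝ, ℂ)`. -/
abbrev L2 : Type := Lp ℂ 2 (volume : Measure ℝ)

theorem integrable_testFunction_smul (f : L2) {η : ℝ → ℝ} (hη : Continuous η)
    (hs : HasCompactSupport η) : Integrable fun τ => η τ • f τ :=
  ((Lp.memLp f).locallyIntegrable one_le_two).integrable_smul_left_of_hasCompactSupport hη hs

/-- The pairs `(f, g)` in `L²(ℝ)` with `g = -iħ f'` in the sense of weak derivatives. -/
def translationGraph (ħ : ℝ) : Submodule ℂ (L2 × L2) where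
  carrier := {p | ∀ η : ℝ → ℝ, ContDiff ℝ ∞ η → HasCompactSupport η →
    ∫ τ, η τ • p.2 τ = (Complex.I * ħ) * ∫ τ, deriv η τ • p.1 τ}
  zero_mem' := by
    intro η hη hs
    have h : ∀ θ : ℝ → ℝ, ∫ τ, θ τ • (0 : L2) τ = 0 := by
      intro θ
      rw [integral_congr_ae (g := fun _ => (0 : ℂ)), integral_zero]
      filter_upwards [Lp.coeFn_zero ℂ 2 (volume : Measure ℝ)] with τ hτ
      simp
    simp only [Prod.fst_zero, Prod.snd_zero, h, mul_zero]
  add_mem' := by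
    rintro ⟨f, g⟩ ⟨f', g'⟩ h h' η hη hs
    have key : ∀ (θ : ℝ → ℝ), Continuous θ → HasCompactSupport θ → ∀ u v : L2,
        ∫ τ, θ τ • (u + v : L2) τ = (∫ τ, θ τ • u τ) + ∫ τ, θ τ • v τ := by
      intro θ hθ hc u v
      rw [← integral_add (integrable_testFunction_smul u hθ hc)
        (integrable_testFunction_smul v hθ hc)]
      refine integral_congr_ae ?_
      filter_upwards [Lp.coeFn_add u v] with τ hτ
      rw [hτ, Pi.add_apply, smul_add]
    have h1 := h η hη hs
    have h2 := h' η hη hs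
    simp only [Prod.mk_add_mk] at h1 h2 ⊢
    rw [key _ hη.continuous hs, key _ (hη.continuous_deriv (by simp)) hs.deriv, h1, h2, mul_add]
  smul_mem' := by
    rintro c ⟨f, g⟩ h η hη hs
    have key : ∀ (θ : ℝ → ℝ) (u : L2), ∫ τ, θ τ • (c • u : L2) τ = c * ∫ τ, θ τ • u τ := by
      intro θ u
      rw [← integral_const_mul]
      refine integral_congr_ae ?_
      filter_upwards [Lp.coeFn_smul c u] with τ hτ
      simp only [hτ, Pi.smul_apply, smul_eq_mul, Complex.real_smul]
      ring
    have h1 := h η hη hs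
    simp only [Prod.smul_mk] at h1 ⊢
    rw [key, key, h1]
    ring

/-- The operator `-iħ ∂/∂τ` of `L²(ℝ)`, on the Sobolev space `H¹(ℝ)`. -/
def translationHamiltonian (ħ : ℝ) : L2 →ₗ.[ℂ] L2 := (translationGraph ħ).toLinearPMap

theorem translationHamiltonian_graph (ħ : ℝ) :
    (translationHamiltonian ħ).graph = translationGraph ħ := by
  refine Submodule.toLinearPMap_graph_eq _ ?_
  rintro ⟨f, g⟩ h hf
  have hf' : f = 0 := hf
  subst hf'
  have h0 : ∀ᵐ τ, (g : ℝ → ℂ) τ = 0 := by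
    refine ae_eq_zero_of_integral_contDiff_smul_eq_zero
      ((Lp.memLp g).locallyIntegrable one_le_two) fun η hη hs => ?_
    have := h η hη hs
    rw [this, integral_congr_ae (g := fun _ => (0 : ℂ)), integral_zero, mul_zero]
    filter_upwards [Lp.coeFn_zero ℂ 2 (volume : Measure ℝ)] with τ hτ
    simp
  exact (Lp.eq_zero_iff_ae_eq_zero).2 h0

/-- The pairs `(f, g)` in `L²(ℝ)` with `g(τ) = τ f(τ)`. -/
def positionGraph : Submodule ℂ (L2 × L2) where
  carrier := {p | ∀ᵐ τ : ℝ, p.2 τ = (τ : ℂ) * p.1 τ}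
  zero_mem' := by
    filter_upwards [Lp.coeFn_zero ℂ 2 (volume : Measure ℝ)] with τ hτ
    simp
  add_mem' := by
    rintro ⟨f, g⟩ ⟨f', g'⟩ h h'
    filter_upwards [h, h', Lp.coeFn_add f f', Lp.coeFn_add g g'] with τ h1 h2 h3 h4
    simp only [Prod.mk_add_mk] at h1 h2 ⊢
    rw [h3, h4, Pi.add_apply, Pi.add_apply, h1, h2, mul_add]
  smul_mem' := by
    rintro c ⟨f, g⟩ h
    filter_upwards [h, Lp.coeFn_smul c f, Lp.coeFn_smul c g] with τ h1 h3 h4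
    simp only [Prod.smul_mk] at h1 ⊢
    rw [h3, h4, Pi.smul_apply, Pi.smul_apply, h1, smul_eq_mul, smul_eq_mul]
    ring

/-- The operator of multiplication by `τ` in `L²(ℝ)`, on its maximal domain. -/
def positionOperator : L2 →ₗ.[ℂ] L2 := positionGraph.toLinearPMap

theorem positionOperator_graph : positionOperator.graph = positionGraph := by
  refine Submodule.toLinearPMap_graph_eq _ ?_
  rintro ⟨f, g⟩ h hf
  have hf' : f = 0 := hf
  subst hf'
  refine (Lp.eq_zero_iff_ae_eq_zero).2 ?_
  filter_upwards [h, Lp.coeFn_zero ℂ 2 (volume : Measure ℝ)] with τ h1 h2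
  simpa using h1.trans (by rw [h2]; simp)

/-- The unitary map `W` carries the operator `A` to the operator `B`, domains included. -/
def Represents {K L : Type*} [NormedAddCommGroup K] [InnerProductSpace ℂ K]
    [NormedAddCommGroup L] [InnerProductSpace ℂ L] (W : K ≃ₗᵢ[ℂ] L)
    (A : K →ₗ.[ℂ] K) (B : L →ₗ.[ℂ] L) : Prop :=
  ∀ x y : K, (x, y) ∈ A.graph ↔ (W x, W y) ∈ B.graph

/-- `T` is canonically conjugate to `A`: both are self-adjoint, `[T, A] = iħ` on a dense subspace,
and `S(α) = exp (-i α T / ħ)` and `R(t) = exp (-i t A / ħ)` satisfy the Weyl relations. -/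
structure IsCanonicalConjugate {K : Type*} [NormedAddCommGroup K] [InnerProductSpace ℂ K]
    [CompleteSpace K] (ħ : ℝ) (T A : K →ₗ.[ℂ] K) : Prop where
  selfAdjoint_left : IsSelfAdjoint T
  selfAdjoint_right : IsSelfAdjoint A
  dense_commutator : Dense {x : K | ∃ Tx Ax TAx ATx : K, (x, Tx) ∈ T.graph ∧ (x, Ax) ∈ A.graph ∧
    (Ax, TAx) ∈ T.graph ∧ (Tx, ATx) ∈ A.graph}
  commutator : ∀ x Tx Ax TAx ATx : K, (x, Tx) ∈ T.graph → (x, Ax) ∈ A.graph →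
    (Ax, TAx) ∈ T.graph → (Tx, ATx) ∈ A.graph → TAx - ATx = (Complex.I * ħ) • x
  weyl : ∃ S R : UnitaryGroup K, S.hamiltonian ħ = T ∧ R.hamiltonian ħ = A ∧
    ∀ (α t : ℝ) (x : K), S.op α (R.op t x) =
      Complex.exp (-(Complex.I * α * t / ħ)) • R.op t (S.op α x)

/-- The generalized vector `χ` is, on the subspace `V`, a generalized eigenvector of the operator
`T` of `V` with the real eigenvalue `c`: it does not vanish, and `⟨T φ|χ⟩ = c ⟨φ|χ⟩`, for the test
vectors `φ` for which both sides make sense. -/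
def IsGeneralizedEigenvector {A : H →ₗ.[ℂ] H} {V : Submodule ℂ H} (T : V →ₗ.[ℂ] V)
    (χ : GeneralizedVector A) (c : ℝ) : Prop :=
  (∃ (φ Tφ : V) (_ : (φ, Tφ) ∈ T.graph) (hφ : (φ : H) ∈ A.domain)
    (_ : (Tφ : H) ∈ A.domain), χ.pair ⟨φ, hφ⟩ ≠ 0) ∧
  ∀ (φ Tφ : V) (_ : (φ, Tφ) ∈ T.graph) (hφ : (φ : H) ∈ A.domain) (hTφ : (Tφ : H) ∈ A.domain),
    χ.pair ⟨Tφ, hTφ⟩ = (c : ℂ) * χ.pair ⟨φ, hφ⟩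

end Operators

end TimeOp

end

/-! The integrals F(t) of ψ(s) over 0 ≤ s ≤ t are genuine vectors and satisfy F(s + t) = F(s) +
U(s)F(t). Distinguishability says that ⟨U(t)F(ε), F(ε)⟩ = o(ε²) for each fixed t < 0, with no
uniformity in t; the case t > 0 follows by conjugation. The aim is to show that F has the Gram
kernel of white noise, i.e. that of indicator functions of intervals.

For d ≥ 0 the second difference of b ↦ ⟨F(b), F(d)⟩ at x < 0 is ⟨U(x)F(ε), F(ε)⟩ - ⟨U(x - d)F(ε),
F(ε)⟩ = o(ε²). By Schwarz's theorem on symmetric second derivatives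
(`affine_of_tendsto_second_difference`) the function is affine for b ≤ 0, and a second use of the
hypothesis kills its slope (`inner_eq_zero`). Hence past and future integrals are orthogonal,
‖F(t)‖² is additive on t ≥ 0, hence equal to kt by continuity, and the kernel is k(|s| + |t| - |s -
t|)/2, with k > 0 because ψ ≠ 0.

Equal Gram kernels give a unitary map from L²(ℝ) onto the history space, taking step functions to
multiples of F(t) (`exists_unitary`). The cocycle law makes it intertwine translation with U. The
Hamiltonian becomes the generator of translations, and multiplication by τ is transported back as
the time operator. The wave function of φ in the domain is then c times the conjugate of ⟨φ|ψ(τ)⟩;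
its continuity in τ turns almost-everywhere identities into the eigenvector equation at each τ. -/

noncomputable section

namespace TimeOp

/-! ### Stone's theorem: the generator of a unitary group is self-adjoint -/

namespace UnitaryGroup

variable {H : Type*} [NormedAddCommGroup H] [InnerProductSpace ℂ H] (U : UnitaryGroup H)

theorem op_zero (x : H) : U.op 0 x = x := by
  have h := U.op_add 0 0 x
  rw [add_zero] at h
  exact ((U.op 0).injective h).symm

theorem op_neg_op (t : ℝ) (x : H) : U.op (-t) (U.op t x) = x := by
  rw [← U.op_add, neg_add_cancel, U.op_zero]

theorem op_op_neg (t : ℝ) (x : H) : U.op t (U.op (-t) x) = x := by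
  rw [← U.op_add, add_neg_cancel, U.op_zero]

theorem inner_op_left (t : ℝ) (x y : H) : ⟪U.op t x, y⟫_ℂ = ⟪x, U.op (-t) y⟫_ℂ := by
  rw [← (U.op t).inner_map_map x, U.op_op_neg]

theorem inner_op_right (t : ℝ) (x y : H) : ⟪x, U.op t y⟫_ℂ = ⟪U.op (-t) x, y⟫_ℂ := by
  rw [U.inner_op_left, neg_neg]

theorem hasDerivAt_op {x z : H} (h : HasDerivAt (fun t => U.op t x) z 0) (t : ℝ) :
    HasDerivAt (fun s => U.op s x) (U.op t z) t := by
  have h1 : HasDerivAt (fun s => U.op t (U.op s x)) (U.op t z) (t - t) := by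
    rw [sub_self]
    exact ((U.op t).toContinuousLinearEquiv.toContinuousLinearMap.restrictScalars
      ℝ).hasFDerivAt.comp_hasDerivAt (0 : ℝ) h
  have h2 := h1.comp_sub_const t t
  simpa [← U.op_add] using h2

theorem mem_graph_hamiltonian {ħ : ℝ} (hħ : ħ ≠ 0) (x y : H) :
    (x, y) ∈ (U.hamiltonian ħ).graph ↔
      HasDerivAt (fun t => U.op t x) ((Complex.I * ħ)⁻¹ • y) 0 := by
  have hc : (Complex.I * ħ : ℂ) ≠ 0 := by simp [hħ]
  rw [LinearPMap.mem_graph_iff]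
  constructor
  · rintro ⟨⟨x', hx⟩, rfl, rfl⟩
    change HasDerivAt _ ((Complex.I * ħ)⁻¹ • (Complex.I * ħ : ℂ) • deriv (fun t => U.op t x') 0) 0
    rw [inv_smul_smul₀ hc]
    exact DifferentiableAt.hasDerivAt hx
  · intro h
    refine ⟨⟨x, h.differentiableAt⟩, rfl, ?_⟩
    change (Complex.I * ħ : ℂ) • deriv (fun t => U.op t x) 0 = y
    rw [h.deriv, smul_inv_smul₀ hc]

theorem hasDerivAt_op_domain {ħ : ℝ} (hħ : ħ ≠ 0) (x : (U.hamiltonian ħ).domain) :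
    HasDerivAt (fun t => U.op t (x : H)) ((Complex.I * ħ)⁻¹ • U.hamiltonian ħ x) 0 :=
  (U.mem_graph_hamiltonian hħ _ _).1 ((U.hamiltonian ħ).mem_graph x)

variable [CompleteSpace H]

theorem hasDerivAt_integral_op (x : H) (t : ℝ) :
    HasDerivAt (fun t => ∫ s in (0 : ℝ)..t, U.op s x) (U.op t x) t :=
  intervalIntegral.integral_hasDerivAt_right ((U.continuous_op x).intervalIntegrable _ _)
    (U.continuous_op x).aestronglyMeasurable.stronglyMeasurableAtFilter
    (U.continuous_op x).continuousAt

/-- A weak derivative of an orbit, tested on a family of vectors that separates points, is a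
strong one. -/
theorem hasDerivAt_op_of_weak {S : Set H} (hS : ∀ w : H, (∀ φ ∈ S, ⟪φ, w⟫_ℂ = 0) → w = 0)
    {x z : H} (h : ∀ φ ∈ S, ∀ t : ℝ, HasDerivAt (fun t => ⟪φ, U.op t x⟫_ℂ) ⟪φ, U.op t z⟫_ℂ t) :
    HasDerivAt (fun t => U.op t x) z 0 := by
  have key : ∀ t : ℝ, U.op t x = x + ∫ s in (0 : ℝ)..t, U.op s z := by
    intro t
    rw [← sub_eq_zero]
    refine hS _ fun φ hφ => ?_
    have hd : ∀ r : ℝ, HasDerivAt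
        (fun r => ⟪φ, U.op r x - (x + ∫ s in (0 : ℝ)..r, U.op s z)⟫_ℂ) 0 r := by
      intro r
      have h1 : HasDerivAt (fun r => ⟪φ, ∫ s in (0 : ℝ)..r, U.op s z⟫_ℂ) ⟪φ, U.op r z⟫_ℂ r := by
        simpa using (hasDerivAt_const r φ).inner ℂ (U.hasDerivAt_integral_op z r)
      have h2 := ((h φ hφ r).sub_const ⟪φ, x⟫_ℂ).sub h1
      rw [sub_self] at h2
      refine h2.congr_of_eventuallyEq (Eventually.of_forall fun r => ?_)
      simp only [inner_sub_right, inner_add_right, Pi.sub_apply]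
      ring
    have hconst := is_const_of_deriv_eq_zero (fun r => (hd r).differentiableAt)
      (fun r => (hd r).deriv) t 0
    simpa [U.op_zero] using hconst
  have h1 := (U.hasDerivAt_integral_op z 0).const_add x
  rw [U.op_zero] at h1
  exact h1.congr_of_eventuallyEq (Eventually.of_forall key)

/-- Applying U(t) shifts the window of integration, so the dependence on t sits in the limits of
integration and is differentiable for every x. Such averages give density of the domain. -/
theorem integral_op_mem_domain (ħ : ℝ) (x : H) (r : ℝ) :
    (∫ s in (0 : ℝ)..r, U.op s x) ∈ (U.hamiltonian ħ).domain := by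
  have hi : ∀ a b : ℝ, IntervalIntegrable (fun s => U.op s x) volume a b :=
    fun a b => (U.continuous_op x).intervalIntegrable a b
  have key : ∀ t : ℝ, U.op t (∫ s in (0 : ℝ)..r, U.op s x) =
      (∫ s in (0 : ℝ)..(r + t), U.op s x) - ∫ s in (0 : ℝ)..t, U.op s x := by
    intro t
    have h1 := (U.op t).toContinuousLinearEquiv.toContinuousLinearMap.intervalIntegral_comp_comm
      (hi 0 r)
    calc U.op t (∫ s in (0 : ℝ)..r, U.op s x) = ∫ s in (0 : ℝ)..r, U.op t (U.op s x) := h1.symm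
      _ = ∫ s in (0 : ℝ)..r, U.op (s + t) x := by simp only [← U.op_add, add_comm]
      _ = ∫ s in (0 + t)..(r + t), U.op s x :=
        intervalIntegral.integral_comp_add_right (fun s => U.op s x) t
      _ = _ := by
        rw [zero_add, intervalIntegral.integral_interval_sub_left (hi _ _) (hi _ _)]
  change DifferentiableAt ℝ (fun t => U.op t (∫ s in (0 : ℝ)..r, U.op s x)) 0
  simp only [key]
  refine DifferentiableAt.sub ?_ (U.hasDerivAt_integral_op x 0).differentiableAt
  exact (((U.hasDerivAt_integral_op x (r + 0)).comp_const_add r 0)).differentiableAt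

theorem dense_domain (ħ : ℝ) : Dense ((U.hamiltonian ħ).domain : Set H) := by
  intro x
  have h := (U.hasDerivAt_integral_op x 0).tendsto_slope_zero_right
  rw [U.op_zero] at h
  refine mem_closure_of_tendsto h (Eventually.of_forall fun t => ?_)
  simp only [zero_add, intervalIntegral.integral_same, sub_zero]
  exact (U.hamiltonian ħ).domain.smul_of_tower_mem t⁻¹ (U.integral_op_mem_domain ħ x t)

/-- The Hamiltonian of a strongly continuous unitary group is self-adjoint. -/
theorem isSelfAdjoint_hamiltonian {ħ : ℝ} (hħ : ħ ≠ 0) : IsSelfAdjoint (U.hamiltonian ħ) := by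
  have hc : (Complex.I * ħ : ℂ) ≠ 0 := by simp [hħ]
  have hconj : starRingEnd ℂ (Complex.I * ħ : ℂ)⁻¹ = -(Complex.I * ħ : ℂ)⁻¹ := by
    simp
  rw [LinearPMap.isSelfAdjoint_def]
  apply LinearPMap.eq_of_eq_graph
  rw [LinearPMap.adjoint_graph_eq_graph_adjoint (U.dense_domain ħ)]
  ext ⟨x, y⟩
  rw [Submodule.mem_adjoint_iff, U.mem_graph_hamiltonian hħ]
  constructor
  · intro h
    -- A vector of the adjoint domain has a weakly differentiable orbit: U(t) is moved onto the test
    -- vector, and the adjoint relation is used at U(-t)φ, which stays in the domain.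
    refine U.hasDerivAt_op_of_weak (S := (U.hamiltonian ħ).domain)
      (fun w hw => (U.dense_domain ħ).eq_zero_of_inner_right ℂ fun v hv => hw v hv) ?_
    intro φ hφ t
    have h1 : HasDerivAt (fun s => U.op (-s) φ)
        (-U.op (-t) ((Complex.I * ħ)⁻¹ • U.hamiltonian ħ ⟨φ, hφ⟩)) t := by
      have := (U.hasDerivAt_op (U.hasDerivAt_op_domain hħ ⟨φ, hφ⟩) (-t)).scomp t (hasDerivAt_neg t)
      simpa using! this
    have h2 := h1.inner ℂ (hasDerivAt_const t x)
    rw [inner_zero_right, zero_add] at h2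
    simp only [← U.inner_op_right] at h2
    refine h2.congr_deriv ?_
    have h3 := h _ _ ((U.hamiltonian ħ).mem_graph
      ⟨U.op (-t) φ, U.op_mem_domain ħ (-t) hφ⟩)
    rw [U.hamiltonian_op ħ (-t) ⟨φ, hφ⟩, sub_eq_zero] at h3
    simp only at h3
    rw [map_smul, map_smul, inner_smul_right, inner_neg_left, inner_smul_left, hconj, h3,
      U.inner_op_right]
    ring
  · intro h a b hab
    have hab' := (U.mem_graph_hamiltonian hħ _ _).1 hab
    -- Symmetry: the inner product of two orbits is constant, so its derivative vanishes.
    have h1 := hab'.inner ℂ h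
    simp only [(U.op _).inner_map_map, U.op_zero] at h1
    have h2 := h1.unique (hasDerivAt_const _ _)
    rw [inner_smul_left, inner_smul_right, hconj] at h2
    have h3 : (Complex.I * ħ : ℂ)⁻¹ * (⟪b, x⟫_ℂ - ⟪a, y⟫_ℂ) = 0 := by linear_combination -h2
    exact (mul_eq_zero.1 h3).resolve_left (inv_ne_zero hc)

end UnitaryGroup

/-! ### Unitary transport and restriction to invariant subspaces -/

section Transport

variable {K L : Type*} [NormedAddCommGroup K] [InnerProductSpace ℂ K]
  [NormedAddCommGroup L] [InnerProductSpace ℂ L]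

/-- The unitary group of `K` that a unitary map `W : K → L` carries to the group `U` of `L`. -/
def UnitaryGroup.pullback (W : K ≃ₗᵢ[ℂ] L) (U : UnitaryGroup L) : UnitaryGroup K where
  op t := (W.trans (U.op t)).trans W.symm
  op_add s t x := by simp [U.op_add]
  continuous_op x := W.symm.continuous.comp (U.continuous_op (W x))

theorem UnitaryGroup.pullback_op (W : K ≃ₗᵢ[ℂ] L) (U : UnitaryGroup L) (t : ℝ) (x : K) :
    (U.pullback W).op t x = W.symm (U.op t (W x)) := rfl

theorem UnitaryGroup.represents_pullback {ħ : ℝ} (hħ : ħ ≠ 0) (W : K ≃ₗᵢ[ℂ] L)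
    (U : UnitaryGroup L) :
    Represents W ((U.pullback W).hamiltonian ħ) (U.hamiltonian ħ) := by
  intro x y
  rw [UnitaryGroup.mem_graph_hamiltonian _ hħ, UnitaryGroup.mem_graph_hamiltonian _ hħ]
  constructor
  · intro h
    have h1 := (W.toContinuousLinearEquiv.toContinuousLinearMap.restrictScalars
      ℝ).hasFDerivAt.comp_hasDerivAt (0 : ℝ) h
    rw [← map_smul]
    refine HasDerivAt.congr_of_eventuallyEq h1 (Eventually.of_forall fun t => ?_)
    simp [UnitaryGroup.pullback_op]
  · intro h
    rw [← map_smul] at h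
    have h1 := (W.symm.toContinuousLinearEquiv.toContinuousLinearMap.restrictScalars
      ℝ).hasFDerivAt.comp_hasDerivAt (0 : ℝ) h
    have h2 : HasDerivAt (fun t => (U.pullback W).op t x)
      (W.symm (W ((Complex.I * ħ)⁻¹ • y))) 0 := h1
    rwa [W.symm_apply_apply] at h2

variable {V : Submodule ℂ K}

/-- The restriction of a unitary group to an invariant subspace. -/
def UnitaryGroup.restrict (U : UnitaryGroup K) (hV : ∀ t, ∀ x ∈ V, U.op t x ∈ V) :
    UnitaryGroup V where
  op t :=
    { toFun := fun x => ⟨U.op t x, hV t x x.2⟩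
      map_add' := fun x y => by ext; simp
      map_smul' := fun c x => by ext; simp
      invFun := fun x => ⟨U.op (-t) x, hV (-t) x x.2⟩
      left_inv := fun x => by ext; simp [U.op_neg_op]
      right_inv := fun x => by ext; simp [U.op_op_neg]
      norm_map' := fun x => (U.op t).norm_map x }
  op_add s t x := by ext; exact U.op_add s t x
  continuous_op x := (U.continuous_op x).subtype_mk _

theorem UnitaryGroup.coe_restrict_op (U : UnitaryGroup K) (hV : ∀ t, ∀ x ∈ V, U.op t x ∈ V)
    (t : ℝ) (x : V) : ((U.restrict hV).op t x : K) = U.op t x := rfl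

/-- Difference quotients converge in V exactly when they converge in K to a point of V, since V
carries the subspace topology. -/
theorem UnitaryGroup.hamiltonian_restrict {ħ : ℝ} (hħ : ħ ≠ 0) (U : UnitaryGroup K)
    (hV : ∀ t, ∀ x ∈ V, U.op t x ∈ V) :
    (U.restrict hV).hamiltonian ħ = restrictTo (U.hamiltonian ħ) V := by
  apply LinearPMap.eq_of_eq_graph
  ext ⟨x, y⟩
  rw [mem_graph_restrictTo, UnitaryGroup.mem_graph_hamiltonian _ hħ,
    UnitaryGroup.mem_graph_hamiltonian _ hħ]
  simp only [hasDerivAt_iff_tendsto_slope_zero]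
  rw [tendsto_subtype_rng]
  rfl

theorem UnitaryGroup.hamiltonian_mem_of_isClosed {ħ : ℝ} (hħ : ħ ≠ 0) (U : UnitaryGroup K)
    (hV : ∀ t, ∀ x ∈ V, U.op t x ∈ V) (hc : IsClosed (V : Set K))
    (x : (U.hamiltonian ħ).domain) (hx : (x : K) ∈ V) : U.hamiltonian ħ x ∈ V := by
  have hne : (Complex.I * ħ : ℂ) ≠ 0 := by simp [hħ]
  have h := (U.hasDerivAt_op_domain hħ x).tendsto_slope_zero_right
  have h1 : (Complex.I * ħ : ℂ)⁻¹ • U.hamiltonian ħ x ∈ V := by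
    refine hc.mem_of_tendsto h (Eventually.of_forall fun t => ?_)
    exact V.smul_of_tower_mem _ (V.sub_mem (hV _ _ hx) (hV _ _ hx))
  simpa only [smul_inv_smul₀ hne] using V.smul_mem (Complex.I * ħ : ℂ) h1

end Transport

/-! ### Schwarz's theorem on symmetric second derivatives -/

section Schwarz

/-- A continuous function with vanishing symmetric second derivative, zero at both ends of an
interval, is nonpositive. -/
theorem nonpos_of_tendsto_second_difference {f : ℝ → ℝ} {a b : ℝ}
    (hf : ContinuousOn f (Set.Icc a b))
    (h : ∀ x ∈ Set.Ioo a b,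
      Tendsto (fun ε => (f (x + ε) + f (x - ε) - 2 * f x) / ε ^ 2) (𝓝[>] 0) (𝓝 0))
    (ha : f a = 0) (hb : f b = 0) {x : ℝ} (hx : x ∈ Set.Icc a b) : f x ≤ 0 := by
  have key : ∀ δ > 0, f x ≤ δ * ((x - a) * (b - x)) := by
    intro δ hδ
    -- The parabola adds 2δε² to the second difference. At an interior maximum of g that difference
    -- is nonpositive, which forces the quotient of f below -2δ and contradicts its limit 0.
    set g : ℝ → ℝ := fun y => f y - δ * ((y - a) * (b - y)) with hg
    have hgc : ContinuousOn g (Set.Icc a b) := hf.sub (by fun_prop)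
    obtain ⟨y, hy, hmax⟩ := isCompact_Icc.exists_isMaxOn ⟨x, hx⟩ hgc
    have hgy : g y ≤ 0 := by
      rcases eq_or_lt_of_le hy.1 with rfl | hay
      · simp [hg, ha]
      rcases eq_or_lt_of_le hy.2 with rfl | hyb
      · simp [hg, hb]
      exfalso
      have h1 := h y ⟨hay, hyb⟩
      have h2 : ∀ᶠ ε in 𝓝[>] (0 : ℝ), ε ∈ Set.Ioo 0 (min (y - a) (b - y)) :=
        Ioo_mem_nhdsGT (lt_min (by linarith) (by linarith))
      have h3 : ∀ᶠ ε in 𝓝[>] (0 : ℝ),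
          (f (y + ε) + f (y - ε) - 2 * f y) / ε ^ 2 ≤ -(2 * δ) := by
        filter_upwards [h2] with ε hε
        have hε1 := lt_of_lt_of_le hε.2 (min_le_left _ _)
        have hε2 := lt_of_lt_of_le hε.2 (min_le_right _ _)
        have hp : g (y + ε) ≤ g y := hmax ⟨by linarith [hε.1], by linarith⟩
        have hm : g (y - ε) ≤ g y := hmax ⟨by linarith, by linarith [hε.1]⟩
        rw [div_le_iff₀ (by have := hε.1; positivity)]
        simp only [hg] at hp hm
        nlinarith
      have := le_of_tendsto h1 h3
      linarith
    have := (hmax hx).trans hgy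
    simp only [hg] at this
    linarith
  have hlim : Tendsto (fun δ : ℝ => δ * ((x - a) * (b - x))) (𝓝[>] 0) (𝓝 0) := by
    have : Tendsto (fun δ : ℝ => δ * ((x - a) * (b - x))) (𝓝 0) (𝓝 (0 * ((x - a) * (b - x)))) :=
      tendsto_id.mul_const _
    rw [zero_mul] at this
    exact this.mono_left nhdsWithin_le_nhds
  exact ge_of_tendsto hlim (eventually_mem_nhdsWithin.mono fun δ hδ => key δ hδ)

/-- A continuous function with vanishing symmetric second derivative is affine. -/
theorem affine_of_tendsto_second_difference {f : ℝ → ℂ} {a b : ℝ}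
    (hf : ContinuousOn f (Set.Icc a b))
    (h : ∀ x ∈ Set.Ioo a b,
      Tendsto (fun ε : ℝ => (f (x + ε) + f (x - ε) - 2 * f x) / (ε : ℂ) ^ 2) (𝓝[>] 0) (𝓝 0))
    {x : ℝ} (hx : x ∈ Set.Icc a b) :
    (b - a) * f x = (b - x) * f a + (x - a) * f b := by
  set g : ℝ → ℂ := fun y => (b - a) * f y - ((b - y) * f a + (y - a) * f b) with hg
  have hgc : ContinuousOn g (Set.Icc a b) :=
    (continuousOn_const.mul hf).sub (by fun_prop)
  -- Every complex multiple w is allowed, so that w = conj (g x) yields |g x|² ≤ 0.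
  have hgx : ∀ w : ℂ, (w * g x).re ≤ 0 := by
    intro w
    refine nonpos_of_tendsto_second_difference (f := fun y => (w * g y).re) (a := a) (b := b)
      (Complex.continuous_re.comp_continuousOn (continuousOn_const.mul hgc)) ?_ ?_ ?_ hx
    · intro y hy
      have h1 := (h y hy).const_mul (w * (b - a))
      rw [mul_zero] at h1
      have h2 := (Complex.continuous_re.tendsto 0).comp h1
      refine Tendsto.congr (fun ε => ?_) h2
      simp only [Function.comp_apply, hg]
      rw [← Complex.add_re, ← Complex.re_ofReal_mul 2, ← Complex.sub_re, ← Complex.div_ofReal_re]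
      push_cast
      congr 1
      ring
    · simp [hg]
    · simp [hg]
  have h0 : g x = 0 := by
    have h1 := hgx (starRingEnd ℂ (g x))
    rw [mul_comm, Complex.mul_conj, Complex.ofReal_re] at h1
    exact Complex.normSq_eq_zero.1 (le_antisymm h1 (Complex.normSq_nonneg _))
  exact sub_eq_zero.1 h0

end Schwarz

/-! ### The Gram kernel of the integrated orbit -/

section Increments

variable {H : Type*} [NormedAddCommGroup H] [InnerProductSpace ℂ H]

/-- A continuous curve `F` with `F (s + t) = F s + U s (F t)`: the integral from `0` to `t` of an
orbit of a possibly generalized vector. -/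
structure UnitaryGroup.Cocycle (U : UnitaryGroup H) (F : ℝ → H) : Prop where
  continuous : Continuous F
  add : ∀ s t, F (s + t) = F s + U.op s (F t)

namespace UnitaryGroup.Cocycle

variable {U : UnitaryGroup H} {F : ℝ → H}

theorem zero (hF : U.Cocycle F) : F 0 = 0 := by
  have h := hF.add 0 0
  simpa [U.op_zero] using h

theorem op_apply (hF : U.Cocycle F) (s t : ℝ) : U.op s (F t) = F (s + t) - F s := by
  rw [hF.add, add_sub_cancel_left]

theorem op_neg_self (hF : U.Cocycle F) (s : ℝ) : U.op (-s) (F s) = -F (-s) := by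
  rw [hF.op_apply, neg_add_cancel, hF.zero, zero_sub]

/-- Both F(d) - U(ε)F(d) and F(ε) - U(d)F(ε) equal F(d) + F(ε) - F(d + ε). This symmetry replaces
F(d) by F(ε) in the second difference, leaving two terms controlled by the hypothesis at the
negative times x and x - d. -/
theorem inner_eq_neg_mul (hF : U.Cocycle F)
    (h : ∀ t < 0, Tendsto (fun ε : ℝ => ⟪U.op t (F ε), F ε⟫_ℂ / (ε : ℂ) ^ 2) (𝓝[>] 0) (𝓝 0))
    {b d : ℝ} (hb : b ≤ 0) (hd : 0 ≤ d) : ⟪F b, F d⟫_ℂ = -b * ⟪F (-1), F d⟫_ℂ := by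
  have hc : Continuous fun b => ⟪F b, F d⟫_ℂ := hF.continuous.inner continuous_const
  have h2 : ∀ x < 0, Tendsto (fun ε : ℝ =>
      (⟪F (x + ε), F d⟫_ℂ + ⟪F (x - ε), F d⟫_ℂ - 2 * ⟪F x, F d⟫_ℂ) / (ε : ℂ) ^ 2)
      (𝓝[>] 0) (𝓝 0) := by
    intro x hx
    have h3 := (h x hx).sub (h (x - d) (by linarith))
    rw [sub_zero] at h3
    refine Tendsto.congr (fun ε => ?_) h3
    rw [← sub_div]
    congr 1
    have e1 : F (x + ε) + F (x - ε) - (2 : ℂ) • F x = U.op x (F ε) - U.op (x - ε) (F ε) := by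
      rw [hF.op_apply, hF.op_apply, sub_add_cancel, two_smul]
      abel
    have e2 : F d - U.op ε (F d) = F ε - U.op d (F ε) := by
      rw [hF.op_apply, hF.op_apply, add_comm d ε]
      abel
    have e3 : ⟪U.op x (F ε), F d - U.op ε (F d)⟫_ℂ = ⟪U.op x (F ε), F ε - U.op d (F ε)⟫_ℂ := by
      rw [e2]
    have e4 := congrArg (fun v => ⟪v, F d⟫_ℂ) e1
    simp only [inner_sub_left, inner_add_left, inner_smul_left, map_ofNat] at e4
    rw [e4]
    rw [inner_sub_right, inner_sub_right, U.inner_op_right ε, U.inner_op_right d, ← U.op_add,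
      ← U.op_add, neg_add_eq_sub, neg_add_eq_sub] at e3
    linear_combination -e3
  have h0 : ∀ a x : ℝ, a ≤ x → x ≤ 0 → -a * ⟪F x, F d⟫_ℂ = -x * ⟪F a, F d⟫_ℂ := by
    intro a x hax hx
    have := affine_of_tendsto_second_difference (f := fun b => ⟪F b, F d⟫_ℂ) (a := a) (b := 0)
      hc.continuousOn (fun y hy => h2 y hy.2) ⟨hax, hx⟩
    simpa [hF.zero] using this
  -- The interpolation interval starts at the lower of -1 and b and ends at 0, where F vanishes.
  rcases le_total (-1) b with hb1 | hb1
  · simpa using h0 (-1) b hb1 hb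
  · simpa using (h0 b (-1) hb1 (by norm_num)).symm

/-- The slope g(d) = ⟨F(-1), F(d)⟩ is additive on d ≥ 0 and is o(d) at 0, so g(d) = n g(d/n) tends
to 0. -/
theorem inner_eq_zero (hF : U.Cocycle F)
    (h : ∀ t < 0, Tendsto (fun ε : ℝ => ⟪U.op t (F ε), F ε⟫_ℂ / (ε : ℂ) ^ 2) (𝓝[>] 0) (𝓝 0))
    {b d : ℝ} (hb : b ≤ 0) (hd : 0 ≤ d) : ⟪F b, F d⟫_ℂ = 0 := by
  set g : ℝ → ℂ := fun d => ⟪F (-1), F d⟫_ℂ with hg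
  have hlim : Tendsto (fun ε : ℝ => g ε / (ε : ℂ)) (𝓝[>] 0) (𝓝 0) := by
    -- At t = -1 the vector U(t)F(ε) is F(ε - 1) - F(-1), so for ε < 1 its inner product with F(ε)
    -- is ((1 - ε) - 1)g(ε) = -εg(ε).
    have h1 := (h (-1) (by norm_num)).neg
    rw [neg_zero] at h1
    refine Tendsto.congr' ?_ h1
    filter_upwards [Ioo_mem_nhdsGT (zero_lt_one' ℝ)] with ε hε
    have hε0 : (ε : ℂ) ≠ 0 := by exact_mod_cast hε.1.ne'
    rw [hF.op_apply, inner_sub_left, hF.inner_eq_neg_mul h (b := -1 + ε) (by linarith [hε.2])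
      hε.1.le]
    simp only [hg]
    push_cast
    field_simp
    ring
  have hadd : ∀ d ε, 0 ≤ d → 0 ≤ ε → g (d + ε) = g d + g ε := by
    intro d ε hd hε
    simp only [hg]
    rw [hF.add, inner_add_right, U.inner_op_right, hF.op_apply, inner_sub_left,
      hF.inner_eq_neg_mul h (b := -d + -1) (by linarith) hε,
      hF.inner_eq_neg_mul h (b := -d) (by linarith) hε]
    push_cast
    ring
  have hmul : ∀ (n : ℕ) (e : ℝ), 0 ≤ e → g (n * e) = n * g e := by
    intro n e he
    induction n with
    | zero => simp [hg, hF.zero]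
    | succ n ih =>
      push_cast
      rw [add_mul, one_mul, hadd _ _ (by positivity) he, ih]
      ring
  have hg0 : g d = 0 := by
    rcases hd.eq_or_lt with rfl | hd
    · simp [hg, hF.zero]
    have h1 : Tendsto (fun n : ℕ => d / ((n : ℝ) + 1)) atTop (𝓝[>] 0) := by
      refine tendsto_nhdsWithin_iff.2 ⟨?_, Eventually.of_forall fun n => ?_⟩
      · simpa [div_eq_mul_inv] using tendsto_one_div_add_atTop_nhds_zero_nat.const_mul d
      · exact div_pos hd (by positivity)
    have h2 := (hlim.comp h1).const_mul (d : ℂ)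
    rw [mul_zero] at h2
    have hd0 : (d : ℂ) ≠ 0 := by exact_mod_cast hd.ne'
    refine tendsto_nhds_unique (Tendsto.congr (fun n => ?_) tendsto_const_nhds) h2
    have hn : ((n : ℝ) + 1) ≠ 0 := by positivity
    have hn' : ((n : ℂ) + 1) ≠ 0 := by exact_mod_cast hn
    have h3 := hmul (n + 1) (d / ((n : ℝ) + 1)) (by positivity)
    rw [show ((n + 1 : ℕ) : ℝ) * (d / ((n : ℝ) + 1)) = d by push_cast; field_simp] at h3
    rw [h3]
    simp only [Function.comp_apply]
    push_cast
    field_simp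
  rw [hF.inner_eq_neg_mul h hb hd]
  exact mul_eq_zero_of_right _ hg0

/-- The increments of `F` behave like those of the indicator functions of intervals. -/
theorem exists_inner_eq (hF : U.Cocycle F)
    (h : ∀ t < 0, Tendsto (fun ε : ℝ => ⟪U.op t (F ε), F ε⟫_ℂ / (ε : ℂ) ^ 2) (𝓝[>] 0) (𝓝 0)) :
    ∃ k : ℝ, 0 ≤ k ∧ ∀ s t, ⟪F s, F t⟫_ℂ = k * ((|s| + |t| - |s - t|) / 2 : ℝ) := by
  have hself : ∀ t, ⟪F (-t), F (-t)⟫_ℂ = ⟪F t, F t⟫_ℂ := by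
    intro t
    rw [← (U.op (-t)).inner_map_map (F t), hF.op_neg_self, inner_neg_neg]
  -- Only the common part contributes: moving U(s) to the left turns F(s) into -F(-s), which is
  -- orthogonal to F(t - s).
  have hpos : ∀ s t, 0 ≤ s → s ≤ t → ⟪F s, F t⟫_ℂ = ⟪F s, F s⟫_ℂ := by
    intro s t hs hst
    have h1 := hF.add s (t - s)
    rw [add_sub_cancel] at h1
    rw [h1, inner_add_right, U.inner_op_right, hF.op_neg_self, inner_neg_left,
      hF.inner_eq_zero h (b := -s) (d := t - s) (by linarith) (by linarith), neg_zero, add_zero]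
  have hneg : ∀ s t, 0 ≤ s → s ≤ t → ⟪F (-s), F (-t)⟫_ℂ = ⟪F s, F s⟫_ℂ := by
    intro s t hs hst
    have h1 := hF.add (-s) (s - t)
    rw [show -s + (s - t) = -t by ring] at h1
    rw [h1, inner_add_right, U.inner_op_right, hF.op_neg_self, inner_neg_left, hself, neg_neg,
      ← inner_conj_symm (F s) (F (s - t)),
      hF.inner_eq_zero h (b := s - t) (by linarith) hs, map_zero, neg_zero, add_zero]
  have hadd : ∀ s t, 0 ≤ s → 0 ≤ t →
      ⟪F (s + t), F (s + t)⟫_ℂ = ⟪F s, F s⟫_ℂ + ⟪F t, F t⟫_ℂ := by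
    intro s t hs ht
    have h1 := hpos s (s + t) hs (by linarith)
    have h2 : ⟪F (s + t), F s⟫_ℂ = ⟪F s, F s⟫_ℂ := by
      rw [← inner_conj_symm, h1, inner_conj_symm]
    have h3 := (U.op s).inner_map_map (F t) (F t)
    rw [hF.op_apply, inner_sub_sub_self, h1, h2] at h3
    linear_combination h3
  have hlin : ∀ x : ℝ, 0 ≤ x → ⟪F x, F x⟫_ℂ = x * ⟪F 1, F 1⟫_ℂ := by
    -- Additivity makes the second differences vanish exactly for small ε, so the affine criterion
    -- also solves this Cauchy equation.
    have h0 : ∀ b x : ℝ, 0 ≤ x → x ≤ b → b * ⟪F x, F x⟫_ℂ = x * ⟪F b, F b⟫_ℂ := by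
      intro b x hx hxb
      have := affine_of_tendsto_second_difference (f := fun x => ⟪F x, F x⟫_ℂ) (a := 0) (b := b)
        (hF.continuous.inner hF.continuous).continuousOn ?_ ⟨hx, hxb⟩
      · simpa [hF.zero] using this
      intro y hy
      refine Tendsto.congr' ?_ tendsto_const_nhds
      filter_upwards [Ioo_mem_nhdsGT hy.1] with ε hε
      have h1 := hadd y ε hy.1.le hε.1.le
      have h2 := hadd (y - ε) ε (by linarith [hε.2]) hε.1.le
      rw [sub_add_cancel] at h2
      rw [h1, h2]
      ring
    intro x hx
    rcases le_total x 1 with hx1 | hx1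
    · simpa using h0 1 x hx hx1
    · simpa using (h0 x 1 zero_le_one hx1).symm
  have hk : ⟪F 1, F 1⟫_ℂ = ((‖F 1‖ ^ 2 : ℝ) : ℂ) := by
    rw [inner_self_eq_norm_sq_to_K]; push_cast; rfl
  have key : ∀ s t, s ≤ t → ⟪F s, F t⟫_ℂ = (‖F 1‖ ^ 2 : ℝ) * ((|s| + |t| - |s - t|) / 2 : ℝ) := by
    intro s t hst
    rcases le_total 0 s with hs | hs
    · rw [hpos s t hs hst, hlin s hs, hk, abs_of_nonneg hs, abs_of_nonneg (hs.trans hst),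
        abs_of_nonpos (by linarith)]
      push_cast
      ring
    rcases le_total 0 t with ht | ht
    · rw [hF.inner_eq_zero h hs ht, abs_of_nonpos hs, abs_of_nonneg ht,
        abs_of_nonpos (by linarith)]
      push_cast
      ring
    · have h1 := hneg (-t) (-s) (by linarith) (by linarith)
      rw [neg_neg, neg_neg] at h1
      rw [← inner_conj_symm, h1, hlin _ (by linarith), hk, abs_of_nonpos hs, abs_of_nonpos ht,
        abs_of_nonpos (by linarith)]
      simp only [map_mul, Complex.conj_ofReal]
      push_cast
      ring
  refine ⟨‖F 1‖ ^ 2, by positivity, fun s t => ?_⟩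
  rcases le_total s t with hst | hst
  · exact key s t hst
  · rw [← inner_conj_symm, key t s hst, map_mul, Complex.conj_ofReal, Complex.conj_ofReal,
      abs_sub_comm, add_comm |t|]

end UnitaryGroup.Cocycle

end Increments

/-! ### Step functions and translations in L²(ℝ) -/

section StepFunctions

theorem ae_eq_zero_of_intervalIntegral_eq_zero {f : ℝ → ℂ} (hf : LocallyIntegrable f)
    (h : ∀ t, ∫ x in (0 : ℝ)..t, f x = 0) : ∀ᵐ x, f x = 0 := by
  filter_upwards [_root_.LocallyIntegrable.ae_hasDerivAt_integral hf] with x hx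
  have h1 := hx 0
  simp only [h] at h1
  exact h1.unique (hasDerivAt_const x (0 : ℂ))

theorem locallyIntegrable_coeFn (f : L2) : LocallyIntegrable (f : ℝ → ℂ) :=
  (Lp.memLp f).locallyIntegrable one_le_two

/-- The indicator function of `(0, t]` for `t ≥ 0`, and minus that of `(t, 0]` for `t ≤ 0`. -/
def step (t : ℝ) : L2 :=
  indicatorConstLp 2 (measurableSet_Ioc (a := 0) (b := t)) measure_Ioc_lt_top.ne 1 -
    indicatorConstLp 2 (measurableSet_Ioc (a := t) (b := 0)) measure_Ioc_lt_top.ne 1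

/-- This form holds for either sign of t, and it telescopes under translation; hence the cocycle law
for step functions without case distinctions. -/
theorem coeFn_step (t : ℝ) : ∀ᵐ x : ℝ, step t x =
    (if x ≤ t then (1 : ℂ) else 0) - if x ≤ 0 then 1 else 0 := by
  filter_upwards [Lp.coeFn_sub
    (indicatorConstLp 2 (measurableSet_Ioc (a := 0) (b := t)) measure_Ioc_lt_top.ne (1 : ℂ))
    (indicatorConstLp 2 (measurableSet_Ioc (a := t) (b := 0)) measure_Ioc_lt_top.ne (1 : ℂ)),
    indicatorConstLp_coeFn (p := 2) (hs := measurableSet_Ioc (a := 0) (b := t))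
      (hμs := measure_Ioc_lt_top.ne) (c := (1 : ℂ)) (μ := volume),
    indicatorConstLp_coeFn (p := 2) (hs := measurableSet_Ioc (a := t) (b := 0))
      (hμs := measure_Ioc_lt_top.ne) (c := (1 : ℂ)) (μ := volume)] with x h1 h2 h3
  rw [step, h1, Pi.sub_apply, h2, h3]
  simp only [Set.indicator_apply, Set.mem_Ioc, ← not_le]
  by_cases h4 : x ≤ t <;> by_cases h5 : x ≤ 0 <;> simp only [h4, h5] <;> simp

theorem inner_step_left (t : ℝ) (f : L2) : ⟪step t, f⟫_ℂ = ∫ x in (0 : ℝ)..t, f x := by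
  rw [step, inner_sub_left, L2.inner_indicatorConstLp_one, L2.inner_indicatorConstLp_one,
    intervalIntegral]

theorem inner_step_step (s t : ℝ) :
    ⟪step s, step t⟫_ℂ = ((|s| + |t| - |s - t|) / 2 : ℝ) := by
  simp only [step, inner_sub_left, inner_sub_right,
    L2.inner_indicatorConstLp_one_indicatorConstLp_one, Set.Ioc_inter_Ioc, Real.volume_real_Ioc]
  rw [← RCLike.ofReal_sub, ← RCLike.ofReal_sub, ← RCLike.ofReal_sub]
  refine congrArg Complex.ofReal ?_
  rcases le_total 0 s with h1 | h1 <;> rcases le_total 0 t with h2 | h2 <;>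
    rcases le_total s t with h3 | h3 <;>
    simp [h1, h2, h3, abs_of_nonneg, abs_of_nonpos] <;> linarith

theorem eq_zero_of_inner_step (f : L2) (h : ∀ t, ⟪step t, f⟫_ℂ = 0) : f = 0 :=
  Lp.eq_zero_iff_ae_eq_zero.2 <| ae_eq_zero_of_intervalIntegral_eq_zero
    (locallyIntegrable_coeFn f) fun t => by rw [← inner_step_left, h]

/-- A function orthogonal to all steps has vanishing primitive, hence vanishes almost everywhere by
Lebesgue differentiation. -/
theorem denseRange_linearCombination_step :
    DenseRange (Finsupp.linearCombination ℂ step : (ℝ →₀ ℂ) →ₗ[ℂ] L2) := by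
  rw [DenseRange, ← LinearMap.coe_range, Submodule.dense_iff_topologicalClosure_eq_top,
    Submodule.topologicalClosure_eq_top_iff, Submodule.eq_bot_iff]
  intro f hf
  refine eq_zero_of_inner_step f fun t => ?_
  exact (Submodule.mem_orthogonal _ _).1 hf (step t) ⟨Finsupp.single t 1, by simp⟩

/-- Translation `f ↦ f(· - t)` of `L²(ℝ)`. -/
def translate (t : ℝ) : L2 →ₗᵢ[ℂ] L2 :=
  Lp.compMeasurePreservingₗᵢ ℂ (fun x => x - t) (measurePreserving_sub_right volume t)

theorem coeFn_translate (t : ℝ) (f : L2) : ∀ᵐ x : ℝ, translate t f x = f (x - t) :=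
  Lp.coeFn_compMeasurePreserving f (measurePreserving_sub_right volume t)

theorem translate_step (t s : ℝ) : translate t (step s) = step (t + s) - step t := by
  refine Lp.ext ?_
  filter_upwards [coeFn_translate t (step s), Lp.coeFn_sub (step (t + s)) (step t),
    (measurePreserving_sub_right volume t).quasiMeasurePreserving.ae (coeFn_step s),
    coeFn_step t, coeFn_step (t + s)] with x h1 h2 h3 h4 h5
  rw [h1, h2, Pi.sub_apply, h3, h4, h5]
  simp only [sub_le_iff_le_add, zero_add, add_comm s t]
  ring

end StepFunctions

/-! ### Test functions and the commutation relation -/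

section TestFunctions

/-- Membership in `C_c^∞(ℝ)` of an element of `L²(ℝ)`. -/
def IsTest (f : L2) : Prop :=
  ∃ g : ℝ → ℂ, f =ᵐ[volume] g ∧ HasCompactSupport g ∧ ContDiff ℝ ∞ g

theorem dense_isTest : Dense {f : L2 | IsTest f} :=
  Lp.dense_hasCompactSupport_contDiff (by simp)

theorem exists_isTest_coeFn {g : ℝ → ℂ} (hc : HasCompactSupport g) (hg : ContDiff ℝ ∞ g) :
    ∃ f : L2, IsTest f ∧ f =ᵐ[volume] g := by
  have h : MemLp g 2 volume := hg.continuous.memLp_of_hasCompactSupport hc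
  exact ⟨h.toLp, ⟨g, h.coeFn_toLp, hc, hg⟩, h.coeFn_toLp⟩

theorem IsTest.exists_position {f : L2} (hf : IsTest f) :
    ∃ p, IsTest p ∧ (f, p) ∈ positionGraph := by
  obtain ⟨g, hfg, hc, hg⟩ := hf
  obtain ⟨p, hp, hpg⟩ := exists_isTest_coeFn (g := fun τ => (τ : ℂ) * g τ) hc.mul_left
    (Complex.ofRealCLM.contDiff.mul hg)
  refine ⟨p, hp, ?_⟩
  change ∀ᵐ τ : ℝ, p τ = (τ : ℂ) * f τ
  filter_upwards [hfg, hpg] with τ h1 h2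
  rw [h1, h2]

theorem IsTest.exists_translation {f : L2} (hf : IsTest f) (ħ : ℝ) :
    ∃ p, IsTest p ∧ (f, p) ∈ translationGraph ħ := by
  obtain ⟨g, hfg, hc, hg⟩ := hf
  have hg' : ContDiff ℝ ∞ (deriv g) := (contDiff_infty_iff_deriv.1 hg).2
  obtain ⟨p, hp, hpg⟩ := exists_isTest_coeFn (g := fun τ => -(Complex.I * ħ) * deriv g τ)
    hc.deriv.mul_left (contDiff_const.mul hg')
  refine ⟨p, hp, fun η hη hs => ?_⟩
  have e1 : ∫ τ, η τ • p τ = -(Complex.I * ħ) * ∫ τ, (η τ : ℂ) * deriv g τ := by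
    rw [← integral_const_mul]
    refine integral_congr_ae ?_
    filter_upwards [hpg] with τ h1
    rw [h1, Complex.real_smul]
    ring
  have e2 : ∫ τ, deriv η τ • f τ = ∫ τ, ((deriv η τ : ℝ) : ℂ) * g τ := by
    refine integral_congr_ae ?_
    filter_upwards [hfg] with τ h1
    rw [h1, Complex.real_smul]
  have hηc : Continuous fun τ => (η τ : ℂ) := Complex.continuous_ofReal.comp hη.continuous
  have hηc' : Continuous fun τ => ((deriv η τ : ℝ) : ℂ) :=
    Complex.continuous_ofReal.comp (hη.continuous_deriv (by simp))
  have e3 : ∫ τ, (η τ : ℂ) * deriv g τ = -∫ τ, ((deriv η τ : ℝ) : ℂ) * g τ := by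
    refine integral_mul_deriv_eq_deriv_mul_of_integrable
      (u := fun τ => (η τ : ℂ)) (v := g)
      (fun x _ => ((hη.differentiable (by simp)).differentiableAt.hasDerivAt (x := x)).ofReal_comp)
      (fun x _ => (hg.differentiable (by simp)).differentiableAt.hasDerivAt) ?_ ?_ ?_
    · exact (hηc.mul hg'.continuous).integrable_of_hasCompactSupport hc.deriv.mul_left
    · exact (hηc'.mul hg.continuous).integrable_of_hasCompactSupport hc.mul_left
    · exact (hηc.mul hg.continuous).integrable_of_hasCompactSupport hc.mul_left
  rw [e1, e2, e3]
  ring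

/-- The canonical commutation relation for `τ` and `-iħ ∂/∂τ`, in terms of weak derivatives. -/
theorem commutator_position_translation {ħ : ℝ} {f p g q h : L2} (hp : (f, p) ∈ positionGraph)
    (hg : (f, g) ∈ translationGraph ħ) (hq : (g, q) ∈ positionGraph)
    (hh : (p, h) ∈ translationGraph ħ) : q - h = (Complex.I * ħ : ℂ) • f := by
  rw [← sub_eq_zero]
  refine Lp.eq_zero_iff_ae_eq_zero.2 (ae_eq_zero_of_integral_contDiff_smul_eq_zero
    (locallyIntegrable_coeFn _) fun η hη hs => ?_)
  have hp' : ∀ᵐ τ : ℝ, p τ = (τ : ℂ) * f τ := hp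
  have hq' : ∀ᵐ τ : ℝ, q τ = (τ : ℂ) * g τ := hq
  have hid : ContDiff ℝ ∞ fun τ : ℝ => τ * η τ := contDiff_id.mul hη
  have hids : HasCompactSupport fun τ : ℝ => τ * η τ := hs.mul_left
  -- Testing against τη(τ) produces the commutator: (τη)' = η + τη', and the extra η is the source
  -- of iħ.
  have e1 := hg _ hid hids
  have e2 := hh η hη hs
  simp only at e1 e2
  have hd : ∀ τ, deriv (fun τ : ℝ => τ * η τ) τ = η τ + τ * deriv η τ := by
    intro τ
    rw [deriv_fun_mul differentiableAt_fun_id (hη.differentiable (by simp)).differentiableAt]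
    simp
  have e3 : ∫ τ, η τ • q τ = ∫ τ : ℝ, (τ * η τ) • g τ := by
    refine integral_congr_ae ?_
    filter_upwards [hq'] with τ h1
    simp only [h1, Complex.real_smul]
    push_cast
    ring
  have hη'c := hη.continuous_deriv (show (1 : WithTop ℕ∞) ≤ ∞ by simp)
  have e4 : ∫ τ, deriv (fun τ : ℝ => τ * η τ) τ • f τ =
      (∫ τ, η τ • f τ) + ∫ τ, deriv η τ • p τ := by
    rw [← integral_add (integrable_testFunction_smul f hη.continuous hs)
      (integrable_testFunction_smul p hη'c hs.deriv)]
    refine integral_congr_ae ?_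
    filter_upwards [hp'] with τ h1
    simp only [h1, hd, Complex.real_smul]
    push_cast
    ring
  have e5 : ∫ τ, η τ • (q - h - (Complex.I * ħ : ℂ) • f : L2) τ =
      (∫ τ, η τ • q τ) - (∫ τ, η τ • h τ) - (Complex.I * ħ) * ∫ τ, η τ • f τ := by
    have hi := fun u : L2 => integrable_testFunction_smul u hη.continuous hs
    rw [← integral_const_mul, ← integral_sub (hi q) (hi h),
      ← integral_sub (f := fun τ => η τ • q τ - η τ • h τ) ((hi q).sub (hi h))
        ((hi f).const_mul _)]
    refine integral_congr_ae ?_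
    filter_upwards [Lp.coeFn_sub (q - h) ((Complex.I * ħ : ℂ) • f), Lp.coeFn_sub q h,
      Lp.coeFn_smul (Complex.I * ħ : ℂ) f] with τ h1 h2 h3
    simp only [h1, h2, h3, Pi.sub_apply, Pi.smul_apply, Complex.real_smul, smul_eq_mul]
    ring
  rw [e5, e3, e1, e4, e2]
  ring

end TestFunctions

/-! ### The phase group and its generator -/

section Position

theorem memLp_mul_unimodular {u : ℝ → ℂ} (hu : Continuous u) (h1 : ∀ x, ‖u x‖ = 1) (f : L2) :
    MemLp (fun x => u x * f x) 2 volume :=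
  (Lp.memLp f).of_le (hu.aestronglyMeasurable.mul (Lp.aestronglyMeasurable f))
    (Eventually.of_forall fun x => by simp [h1])

/-- Multiplication of `L²(ℝ)` by a continuous function of absolute value `1`. -/
def mulUnimodular (u : ℝ → ℂ) (hu : Continuous u) (h1 : ∀ x, ‖u x‖ = 1) : L2 →ₗᵢ[ℂ] L2 where
  toFun f := (memLp_mul_unimodular hu h1 f).toLp
  map_add' f g := by
    rw [← MemLp.toLp_add]
    refine MemLp.toLp_congr _ _ ?_
    filter_upwards [Lp.coeFn_add f g] with x hx
    simp only [hx, Pi.add_apply, mul_add]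
  map_smul' c f := by
    rw [RingHom.id_apply, ← MemLp.toLp_const_smul]
    refine MemLp.toLp_congr _ _ ?_
    filter_upwards [Lp.coeFn_smul c f] with x hx
    simp only [hx, Pi.smul_apply, smul_eq_mul]
    ring
  norm_map' f := by
    change ‖(memLp_mul_unimodular hu h1 f).toLp‖ = _
    rw [Lp.norm_toLp, Lp.norm_def]
    congr 1
    exact eLpNorm_congr_norm_ae (Eventually.of_forall fun x => by simp [h1])

theorem coeFn_mulUnimodular (u : ℝ → ℂ) (hu : Continuous u) (h1 : ∀ x, ‖u x‖ = 1) (f : L2) :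
    ∀ᵐ x : ℝ, mulUnimodular u hu h1 f x = u x * f x :=
  (memLp_mul_unimodular hu h1 f).coeFn_toLp

/-- The phase factor `exp (-i α τ / ħ)`. -/
def phase (ħ α τ : ℝ) : ℂ := Complex.exp (((-(α * τ / ħ) : ℝ) : ℂ) * Complex.I)

theorem norm_phase (ħ α τ : ℝ) : ‖phase ħ α τ‖ = 1 := Complex.norm_exp_ofReal_mul_I _

theorem continuous_phase (ħ α : ℝ) : Continuous (phase ħ α) := by
  unfold phase
  fun_prop

theorem phase_add (ħ α β τ : ℝ) : phase ħ (α + β) τ = phase ħ α τ * phase ħ β τ := by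
  rw [phase, phase, phase, ← Complex.exp_add]
  congr 1
  push_cast
  ring

theorem phase_zero (ħ τ : ℝ) : phase ħ 0 τ = 1 := by simp [phase]

theorem hasDerivAt_phase {ħ : ℝ} (τ : ℝ) :
    HasDerivAt (fun α => phase ħ α τ) ((Complex.I * ħ)⁻¹ * τ) 0 := by
  have h1 : HasDerivAt (fun α : ℝ => -(α * τ / ħ)) (-(1 * τ / ħ)) 0 :=
    (((hasDerivAt_id (0 : ℝ)).mul_const τ).div_const ħ).neg
  have h2 := (h1.ofReal_comp.mul_const Complex.I).cexp
  refine h2.congr_deriv ?_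
  simp only [zero_mul, zero_div, neg_zero, Complex.ofReal_zero, Complex.exp_zero, one_mul, mul_inv,
    Complex.inv_I]
  push_cast
  ring

/-- The operator of multiplication by `exp (-i α τ / ħ)`. -/
def mulPhase (ħ α : ℝ) : L2 →ₗᵢ[ℂ] L2 :=
  mulUnimodular (phase ħ α) (continuous_phase ħ α) (norm_phase ħ α)

theorem coeFn_mulPhase (ħ α : ℝ) (f : L2) : ∀ᵐ τ : ℝ, mulPhase ħ α f τ = phase ħ α τ * f τ :=
  coeFn_mulUnimodular _ _ _ f

theorem mulPhase_add (ħ α β : ℝ) (f : L2) :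
    mulPhase ħ (α + β) f = mulPhase ħ α (mulPhase ħ β f) := by
  refine Lp.ext ?_
  filter_upwards [coeFn_mulPhase ħ (α + β) f, coeFn_mulPhase ħ α (mulPhase ħ β f),
    coeFn_mulPhase ħ β f] with τ h1 h2 h3
  rw [h1, h2, h3, phase_add, mul_assoc]

theorem mulPhase_zero (ħ : ℝ) (f : L2) : mulPhase ħ 0 f = f := by
  refine Lp.ext ?_
  filter_upwards [coeFn_mulPhase ħ 0 f] with τ h1
  rw [h1, phase_zero, one_mul]

/-- For isometries, ‖M(α)f - f‖² = 2‖f‖² - 2 Re⟨f, M(α)f⟩, so dominated convergence for the inner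
product suffices; the group law reduces continuity at β to continuity at 0. -/
theorem continuous_mulPhase (ħ : ℝ) (f : L2) : Continuous fun α => mulPhase ħ α f := by
  have hin : Continuous fun α : ℝ => ⟪f, mulPhase ħ α f⟫_ℂ := by
    have h1 : ∀ α, ⟪f, mulPhase ħ α f⟫_ℂ = ∫ τ, phase ħ α τ * ⟪f τ, f τ⟫_ℂ := by
      intro α
      rw [L2.inner_def]
      refine integral_congr_ae ?_
      filter_upwards [coeFn_mulPhase ħ α f] with τ h1
      rw [h1, ← smul_eq_mul, inner_smul_right]
    simp only [h1]
    have hfint := L2.integrable_inner (𝕜 := ℂ) f f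
    refine continuous_of_dominated (bound := fun τ => ‖⟪f τ, f τ⟫_ℂ‖) ?_ ?_ hfint.norm ?_
    · intro α
      exact (continuous_phase ħ α).aestronglyMeasurable.mul hfint.aestronglyMeasurable
    · intro α
      exact Eventually.of_forall fun τ => by rw [norm_mul, norm_phase, one_mul]
    · refine Eventually.of_forall fun τ => ?_
      unfold phase
      fun_prop
  have hz : ∀ α, ‖mulPhase ħ α f - f‖ ^ 2 = 2 * ‖f‖ ^ 2 - 2 * (⟪f, mulPhase ħ α f⟫_ℂ).re := by
    intro α
    rw [@norm_sub_sq ℂ, LinearIsometry.norm_map, ← inner_conj_symm, RCLike.conj_re]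
    change _ - 2 * (⟪f, mulPhase ħ α f⟫_ℂ).re + _ = _
    ring
  have hc : Continuous fun α : ℝ => ‖mulPhase ħ α f - f‖ := by
    have : ∀ α, ‖mulPhase ħ α f - f‖ = √(2 * ‖f‖ ^ 2 - 2 * (⟪f, mulPhase ħ α f⟫_ℂ).re) := by
      intro α
      rw [← hz, Real.sqrt_sq (norm_nonneg _)]
    simp only [this]
    fun_prop
  rw [continuous_iff_continuousAt]
  intro β
  rw [ContinuousAt, tendsto_iff_norm_sub_tendsto_zero]
  have h1 : ∀ α, ‖mulPhase ħ α f - mulPhase ħ β f‖ = ‖mulPhase ħ (α - β) f - f‖ := by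
    intro α
    rw [← (mulPhase ħ β).norm_map (mulPhase ħ (α - β) f - f), map_sub, ← mulPhase_add,
      add_sub_cancel]
  simp only [h1]
  have h2 := (hc.comp (continuous_sub_right β)).tendsto β
  simpa [Function.comp_def, mulPhase_zero] using h2

/-- The unitary group of multiplication by `exp (-i α τ / ħ)`. -/
def phaseGroup (ħ : ℝ) : UnitaryGroup L2 where
  op α :=
    { (mulPhase ħ α).toLinearMap with
      invFun := mulPhase ħ (-α)
      left_inv := fun f => by
        change mulPhase ħ (-α) (mulPhase ħ α f) = f
        rw [← mulPhase_add, neg_add_cancel, mulPhase_zero]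
      right_inv := fun f => by
        change mulPhase ħ α (mulPhase ħ (-α) f) = f
        rw [← mulPhase_add, add_neg_cancel, mulPhase_zero]
      norm_map' := (mulPhase ħ α).norm_map }
  op_add := mulPhase_add ħ
  continuous_op := continuous_mulPhase ħ

theorem phaseGroup_op (ħ α : ℝ) (f : L2) : (phaseGroup ħ).op α f = mulPhase ħ α f := rfl

theorem inner_positionGraph {f g f' g' : L2} (h : (f, g) ∈ positionGraph)
    (h' : (f', g') ∈ positionGraph) : ⟪g, f'⟫_ℂ = ⟪f, g'⟫_ℂ := by
  have h1 : ∀ᵐ τ : ℝ, g τ = (τ : ℂ) * f τ := h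
  have h2 : ∀ᵐ τ : ℝ, g' τ = (τ : ℂ) * f' τ := h'
  rw [L2.inner_def, L2.inner_def]
  refine integral_congr_ae ?_
  filter_upwards [h1, h2] with τ e1 e2
  rw [e1, e2, ← smul_eq_mul, ← smul_eq_mul, inner_smul_left, inner_smul_right, Complex.conj_ofReal]

/-- The generator of multiplication by `exp (-i α τ / ħ)` is multiplication by `τ`. -/
theorem hamiltonian_phaseGroup {ħ : ℝ} (hħ : ħ ≠ 0) :
    (phaseGroup ħ).hamiltonian ħ = positionOperator := by
  have hc : (Complex.I * ħ : ℂ) ≠ 0 := by simp [hħ]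
  have hle : ∀ f g : L2, (f, g) ∈ ((phaseGroup ħ).hamiltonian ħ).graph →
      (f, g) ∈ positionGraph := by
    intro f g hfg
    have h1 := ((UnitaryGroup.mem_graph_hamiltonian _ hħ _ _).1 hfg).tendsto_slope_zero
    -- Along a suitable sequence the L² limit is also a pointwise one, which identifies it with the
    -- derivative of the phase.
    obtain ⟨ns, hns, hae⟩ := (tendstoInMeasure_of_tendsto_Lp h1).exists_seq_tendsto_ae'
    have h2 : ∀ᵐ τ : ℝ, ∀ n, (((ns n)⁻¹ • ((phaseGroup ħ).op (0 + ns n) f -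
        (phaseGroup ħ).op 0 f) : L2) : ℝ → ℂ) τ
          = ((ns n)⁻¹ • (phase ħ (0 + ns n) τ - phase ħ 0 τ)) * f τ := by
      rw [ae_all_iff]
      intro n
      simp only [phaseGroup_op]
      filter_upwards [Lp.coeFn_smul (ns n)⁻¹ (mulPhase ħ (0 + ns n) f - mulPhase ħ 0 f),
        Lp.coeFn_sub (mulPhase ħ (0 + ns n) f) (mulPhase ħ 0 f),
        coeFn_mulPhase ħ (0 + ns n) f, coeFn_mulPhase ħ 0 f] with τ e1 e2 e3 e4
      rw [e1, Pi.smul_apply, e2, Pi.sub_apply, e3, e4, ← sub_mul, smul_mul_assoc]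
    change ∀ᵐ τ : ℝ, g τ = (τ : ℂ) * f τ
    filter_upwards [hae, h2, Lp.coeFn_smul (Complex.I * ħ : ℂ)⁻¹ g] with τ e1 e2 e3
    have e4 := ((hasDerivAt_phase (ħ := ħ) τ).tendsto_slope_zero.comp hns).mul_const (f τ)
    have e5 := tendsto_nhds_unique e1 (e4.congr fun n => (e2 n).symm)
    rw [e3, Pi.smul_apply, smul_eq_mul, mul_assoc] at e5
    exact mul_left_cancel₀ (inv_ne_zero hc) e5
  -- The reverse inclusion needs no estimate: multiplication by τ is a symmetric extension of a
  -- self-adjoint operator, hence equal to it.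
  have hsa := (phaseGroup ħ).isSelfAdjoint_hamiltonian hħ
  rw [LinearPMap.isSelfAdjoint_def] at hsa
  apply LinearPMap.eq_of_eq_graph
  rw [positionOperator_graph]
  refine le_antisymm (fun (p : L2 × L2) hp => hle p.1 p.2 hp) ?_
  rintro ⟨f, g⟩ hfg
  rw [← hsa, LinearPMap.adjoint_graph_eq_graph_adjoint ((phaseGroup ħ).dense_domain ħ),
    Submodule.mem_adjoint_iff]
  intro a b hab
  rw [inner_positionGraph (hle a b hab) hfg, sub_self]

end Position

/-! ### The generator of translations and the Weyl relation -/

section Translation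

/-- A real test function as a vector of `L²(ℝ)`. -/
def testVector (η : ℝ → ℝ) (hη : Continuous η) (hs : HasCompactSupport η) : L2 :=
  MemLp.toLp (fun x => (η x : ℂ)) <|
    (Complex.continuous_ofReal.comp hη).memLp_of_hasCompactSupport
      (hs.comp_left (g := Complex.ofReal) Complex.ofReal_zero)

theorem inner_testVector {η : ℝ → ℝ} (hη : Continuous η) (hs : HasCompactSupport η) (f : L2) :
    ⟪testVector η hη hs, f⟫_ℂ = ∫ τ, η τ • f τ := by
  rw [L2.inner_def]
  refine integral_congr_ae ?_
  have h : ∀ᵐ x : ℝ, testVector η hη hs x = (η x : ℂ) := MemLp.coeFn_toLp _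
  filter_upwards [h] with x hx
  rw [hx, RCLike.inner_apply', Complex.conj_ofReal, Complex.real_smul]

/-- The integral is the convolution of f with the reflected test function, evaluated at -t. -/
theorem hasDerivAt_integral_shift {f : ℝ → ℂ} (hf : LocallyIntegrable f) {η : ℝ → ℝ}
    (hη : ContDiff ℝ ∞ η) (hs : HasCompactSupport η) (t : ℝ) :
    HasDerivAt (fun t => ∫ x, η (x + t) • f x) (∫ x, deriv η (x + t) • f x) t := by
  set θ : ℝ → ℝ := fun y => η (-y) with hθ
  have hθs : HasCompactSupport θ := hs.comp_homeomorph (Homeomorph.neg ℝ)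
  have hθc : ContDiff ℝ 1 θ := (hη.comp contDiff_neg).of_le (by simp)
  have h1 := hθs.hasDerivAt_convolution_right (ContinuousLinearMap.lsmul ℝ ℝ).flip hf hθc (-t)
  have h2 := h1.scomp t (hasDerivAt_neg t)
  have hd : ∀ y, deriv θ y = -deriv η (-y) := fun y => deriv_comp_neg η y
  refine (h2.congr_deriv ?_).congr_of_eventuallyEq (Eventually.of_forall fun s => ?_)
  · simp only [convolution_def, ContinuousLinearMap.flip_apply, ContinuousLinearMap.lsmul_apply,
      hd, neg_smul, one_smul, integral_neg, neg_neg, neg_sub, sub_neg_eq_add]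
  · simp only [convolution_def, ContinuousLinearMap.flip_apply, ContinuousLinearMap.lsmul_apply,
      hθ, neg_sub, sub_neg_eq_add, Function.comp_apply]

/-- The generator of translations is `-iħ ∂/∂τ`. -/
theorem hamiltonian_eq_translationHamiltonian {ħ : ℝ} (hħ : ħ ≠ 0) (R : UnitaryGroup L2)
    (hR : ∀ t f, R.op t f = translate t f) : R.hamiltonian ħ = translationHamiltonian ħ := by
  have hc : (Complex.I * ħ : ℂ) ≠ 0 := by simp [hħ]
  have hop : ∀ (η : ℝ → ℝ) (t : ℝ) (f : L2), ∫ x, η x • R.op t f x = ∫ x, η (x + t) • f x := by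
    intro η t f
    rw [← integral_sub_right_eq_self (fun x => η (x + t) • f x) t]
    refine integral_congr_ae ?_
    filter_upwards [coeFn_translate t f] with x hx
    rw [hR, hx, sub_add_cancel]
  have hsm : ∀ (η : ℝ → ℝ) (c : ℂ) (f : L2), ∫ x, η x • (c • f : L2) x = c * ∫ x, η x • f x := by
    intro η c f
    rw [← integral_const_mul]
    refine integral_congr_ae ?_
    filter_upwards [Lp.coeFn_smul c f] with x hx
    rw [hx, Pi.smul_apply, smul_eq_mul, mul_smul_comm]
  apply LinearPMap.eq_of_eq_graph
  rw [translationHamiltonian_graph]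
  ext ⟨f, g⟩
  rw [UnitaryGroup.mem_graph_hamiltonian _ hħ]
  constructor
  · intro h η hη hs
    have h1 : HasDerivAt (fun t => ⟪testVector η hη.continuous hs, R.op t f⟫_ℂ)
        ⟪testVector η hη.continuous hs, (Complex.I * ħ : ℂ)⁻¹ • g⟫_ℂ 0 := by
      simpa using (hasDerivAt_const (0 : ℝ) (testVector η hη.continuous hs)).inner ℂ h
    simp only [inner_testVector, hop, hsm] at h1
    have h2 := h1.unique (hasDerivAt_integral_shift (locallyIntegrable_coeFn f) hη hs 0)
    simp only [add_zero] at h2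
    rw [← h2, mul_inv_cancel_left₀ hc]
  · intro h
    -- A weak derivative of f gives weak derivatives of the whole orbit, because a shifted test
    -- function is again a test function; such vectors separate points.
    refine R.hasDerivAt_op_of_weak
      (S := {φ | ∃ (η : ℝ → ℝ) (hη : ContDiff ℝ ∞ η) (hs : HasCompactSupport η),
        φ = testVector η hη.continuous hs}) ?_ ?_
    · intro w hw
      refine Lp.eq_zero_iff_ae_eq_zero.2 (ae_eq_zero_of_integral_contDiff_smul_eq_zero
        (locallyIntegrable_coeFn _) fun η hη hs => ?_)
      rw [← inner_testVector hη.continuous hs]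
      exact hw _ ⟨η, hη, hs, rfl⟩
    · rintro φ ⟨η, hη, hs, rfl⟩ t
      simp only [inner_testVector, hop, map_smul, hsm]
      refine (hasDerivAt_integral_shift (locallyIntegrable_coeFn f) hη hs t).congr_deriv ?_
      have h1 := h (fun x => η (x + t)) (hη.comp (contDiff_id.add contDiff_const))
        (hs.comp_homeomorph (Homeomorph.addRight t))
      simp only [deriv_comp_add_const] at h1
      rw [h1, inv_mul_cancel_left₀ hc]

theorem mulPhase_translate (ħ α t : ℝ) (f : L2) : mulPhase ħ α (translate t f) =
    Complex.exp (-(Complex.I * α * t / ħ)) • translate t (mulPhase ħ α f) := by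
  refine Lp.ext ?_
  filter_upwards [coeFn_mulPhase ħ α (translate t f), coeFn_translate t f,
    Lp.coeFn_smul (Complex.exp (-(Complex.I * α * t / ħ))) (translate t (mulPhase ħ α f)),
    coeFn_translate t (mulPhase ħ α f),
    (measurePreserving_sub_right volume t).quasiMeasurePreserving.ae (coeFn_mulPhase ħ α f)]
    with x h1 h2 h3 h4 h5
  rw [h1, h2, h3, Pi.smul_apply, h4, h5, smul_eq_mul, ← mul_assoc, phase, phase, ← Complex.exp_add]
  congr 2
  push_cast
  ring

end Translation

/-! ### Integrating the orbit of a generalized vector -/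

section Evolve

theorem evolve_zero_pair {H : Type*} [NormedAddCommGroup H] [InnerProductSpace ℂ H] {ħ : ℝ}
    {U : UnitaryGroup H} (ψ : GeneralizedVector (U.hamiltonian ħ))
    (φ : (U.hamiltonian ħ).domain) : (U.evolve ħ ψ 0).pair φ = ψ.pair φ := by
  change ψ.pair ⟨U.op (-0) φ, _⟩ = ψ.pair φ
  congr 1
  ext
  simp [U.op_zero]

end Evolve

section History

variable {H : Type*} [NormedAddCommGroup H] [InnerProductSpace ℂ H] [CompleteSpace H]

/-- A generalized vector is the sum of a vector and of the image of a vector under `A`, in the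
sense of the rigging. -/
theorem GeneralizedVector.exists_pair_eq {A : H →ₗ.[ℂ] H} (ψ : GeneralizedVector A) :
    ∃ u v : H, ∀ φ : A.domain, ψ.pair φ = ⟪(φ : H), u⟫_ℂ + ⟪A φ, v⟫_ℂ := by
  obtain ⟨C, hC⟩ := ψ.bounded
  have hdom : ∀ p : A.graph, p.1.1 ∈ A.domain := fun p => A.mem_domain_of_mem_graph p.2
  have happ : ∀ p : A.graph, A ⟨p.1.1, hdom p⟩ = p.1.2 := fun p =>
    (A.mem_graph_snd_inj (A.mem_graph ⟨p.1.1, hdom p⟩) p.2 rfl)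
  let ℓ₀ : A.graph →ₗ[ℂ] ℂ :=
    { toFun := fun p => starRingEnd ℂ (ψ.pair ⟨p.1.1, hdom p⟩)
      map_add' := fun p q => by
        rw [← map_add, ← map_add]
        rfl
      map_smul' := fun c p => by
        have : (⟨(c • p).1.1, hdom (c • p)⟩ : A.domain) = c • ⟨p.1.1, hdom p⟩ := rfl
        rw [this, map_smulₛₗ, smul_eq_mul, map_mul, RingHomCompTriple.comp_apply]
        rfl }
  have hb : ∀ p, ‖ℓ₀ p‖ ≤ (2 * |C|) * ‖p‖ := by
    intro p
    change ‖starRingEnd ℂ (ψ.pair ⟨p.1.1, hdom p⟩)‖ ≤ _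
    rw [RCLike.norm_conj]
    refine (hC _).trans ?_
    rw [happ]
    have h1 : ‖p.1.1‖ ≤ ‖p‖ := norm_fst_le p.1
    have h2 : ‖p.1.2‖ ≤ ‖p‖ := norm_snd_le p.1
    calc C * (‖p.1.1‖ + ‖p.1.2‖) ≤ |C| * (‖p‖ + ‖p‖) := by
          gcongr
          exact le_abs_self C
      _ = _ := by ring
  -- The conjugate of ψ is a bounded linear functional on the graph of A. Hahn–Banach extends it to
  -- H × H, and the Riesz theorem represents it on each factor.
  obtain ⟨ℓ, hℓ, -⟩ := exists_extension_norm_eq A.graph (ℓ₀.mkContinuous _ hb)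
  let ℓ₁ : StrongDual ℂ H := ℓ.comp (ContinuousLinearMap.inl ℂ H H)
  let ℓ₂ : StrongDual ℂ H := ℓ.comp (ContinuousLinearMap.inr ℂ H H)
  refine ⟨(InnerProductSpace.toDual ℂ H).symm ℓ₁, (InnerProductSpace.toDual ℂ H).symm ℓ₂,
    fun φ => ?_⟩
  have h1 := hℓ ⟨((φ : H), A φ), A.mem_graph φ⟩
  have h2 : ℓ ((φ : H), A φ) = ℓ₁ φ + ℓ₂ (A φ) := by
    simp only [ℓ₁, ℓ₂, ContinuousLinearMap.comp_apply, ContinuousLinearMap.inl_apply,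
      ContinuousLinearMap.inr_apply, ← map_add, Prod.mk_add_mk, add_zero, zero_add]
  have h3 : ℓ ((φ : H), A φ) = starRingEnd ℂ (ψ.pair φ) := h1
  rw [← inner_conj_symm (φ : H), ← inner_conj_symm (A φ), InnerProductSpace.toDual_symm_apply,
    InnerProductSpace.toDual_symm_apply, ← map_add, ← h2, h3, RCLike.conj_conj]

variable {ħ : ℝ} {U : UnitaryGroup H}

theorem continuous_evolve_pair (ψ : GeneralizedVector (U.hamiltonian ħ))
    (φ : (U.hamiltonian ħ).domain) : Continuous fun t => (U.evolve ħ ψ t).pair φ := by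
  obtain ⟨u, v, h⟩ := ψ.exists_pair_eq
  have h1 : ∀ t, (U.evolve ħ ψ t).pair φ =
      ⟪U.op (-t) φ, u⟫_ℂ + ⟪U.op (-t) (U.hamiltonian ħ φ), v⟫_ℂ := by
    intro t
    rw [← U.hamiltonian_op]
    exact h _
  simp only [h1]
  exact (((U.continuous_op _).comp continuous_neg).inner continuous_const).add
    (((U.continuous_op _).comp continuous_neg).inner continuous_const)

/-- The integrals of a generalized orbit from `0` to `t` form a continuous cocycle in `H`. -/
theorem exists_cocycle (hħ : ħ ≠ 0) (ψ : GeneralizedVector (U.hamiltonian ħ)) :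
    ∃ F : ℝ → H, U.Cocycle F ∧ ∀ (φ : (U.hamiltonian ħ).domain) (t : ℝ),
      HasDerivAt (fun t => ⟪(φ : H), F t⟫_ℂ) ((U.evolve ħ ψ t).pair φ) t := by
  have hc : (Complex.I * ħ : ℂ) ≠ 0 := by simp [hħ]
  obtain ⟨u, v, h⟩ := ψ.exists_pair_eq
  have hi : ∀ a b : ℝ, IntervalIntegrable (fun s => U.op s u) volume a b :=
    fun a b => (U.continuous_op u).intervalIntegrable a b
  -- Formally ψ = u + Ĥv, and ĤU(s)v is iħ times the derivative of U(s)v. Integration in time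
  -- therefore removes the unbounded operator.
  refine ⟨fun t => (∫ s in (0 : ℝ)..t, U.op s u) + (Complex.I * ħ : ℂ) • (U.op t v - v),
    ⟨?_, ?_⟩, ?_⟩
  · exact (intervalIntegral.continuous_primitive hi 0).add
      (((U.continuous_op v).sub continuous_const).const_smul _)
  · intro s t
    have h1 : U.op s (∫ r in (0 : ℝ)..t, U.op r u) =
        (∫ r in (0 : ℝ)..(s + t), U.op r u) - ∫ r in (0 : ℝ)..s, U.op r u := by
      have h2 := (U.op s).toContinuousLinearEquiv.toContinuousLinearMap.intervalIntegral_comp_comm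
        (hi 0 t)
      calc U.op s (∫ r in (0 : ℝ)..t, U.op r u) = ∫ r in (0 : ℝ)..t, U.op s (U.op r u) := h2.symm
        _ = ∫ r in (0 : ℝ)..t, U.op (s + r) u := by simp only [← U.op_add]
        _ = ∫ r in (s + 0)..(s + t), U.op r u :=
          intervalIntegral.integral_comp_add_left (fun r => U.op r u) s
        _ = _ := by
          rw [add_zero, intervalIntegral.integral_interval_sub_left (hi _ _) (hi _ _)]
    simp only [map_add, map_smul, map_sub, h1, ← U.op_add, smul_sub]
    abel
  · intro φ t
    have h1 := (hasDerivAt_const t (φ : H)).inner ℂ (U.hasDerivAt_integral_op u t)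
    have h2 : HasDerivAt (fun s => U.op (-s) (φ : H))
        (-U.op (-t) ((Complex.I * ħ)⁻¹ • U.hamiltonian ħ φ)) t := by
      have := (U.hasDerivAt_op (U.hasDerivAt_op_domain hħ φ) (-t)).scomp t (hasDerivAt_neg t)
      simpa using! this
    have h3 := h2.inner ℂ (hasDerivAt_const t v)
    have h4 := h1.add ((h3.sub_const ⟪(φ : H), v⟫_ℂ).const_mul (Complex.I * ħ : ℂ))
    refine (h4.congr_deriv ?_).congr_of_eventuallyEq (Eventually.of_forall fun s => ?_)
    · have h5 : (U.evolve ħ ψ t).pair φ =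
          ⟪U.op (-t) φ, u⟫_ℂ + ⟪U.op (-t) (U.hamiltonian ħ φ), v⟫_ℂ := by
        rw [← U.hamiltonian_op]
        exact h _
      rw [h5, inner_zero_left, inner_zero_right, inner_neg_left, map_smul, inner_smul_left,
        U.inner_op_right t]
      have hconj : starRingEnd ℂ (Complex.I * ħ : ℂ)⁻¹ = -(Complex.I * ħ : ℂ)⁻¹ := by simp
      rw [hconj]
      linear_combination ⟪U.op (-t) (U.hamiltonian ħ φ), v⟫_ℂ * mul_inv_cancel₀ hc
    · simp only [inner_add_right, inner_smul_right, inner_sub_right, U.inner_op_right s,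
        Pi.add_apply]

end History

/-! ### The history space and its identification with L²(ℝ) -/

section HistorySpace

variable {H : Type*} [NormedAddCommGroup H] [InnerProductSpace ℂ H] [CompleteSpace H]
  {ħ : ℝ} {U : UnitaryGroup H} {ψ : GeneralizedVector (U.hamiltonian ħ)} {F : ℝ → H}

/-- The curve `F` consists of the integrals from `0` to `t` of the orbit of `ψ`. -/
structure IsHistoryCurve (U : UnitaryGroup H) (ħ : ℝ) (ψ : GeneralizedVector (U.hamiltonian ħ))
    (F : ℝ → H) : Prop where
  cocycle : U.Cocycle F
  hasDerivAt : ∀ (φ : (U.hamiltonian ħ).domain) (t : ℝ),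
    HasDerivAt (fun t => ⟪(φ : H), F t⟫_ℂ) ((U.evolve ħ ψ t).pair φ) t

namespace IsHistoryCurve

theorem integral_eq (hF : IsHistoryCurve U ħ ψ F) (φ : (U.hamiltonian ħ).domain) (a b : ℝ) :
    ∫ t in a..b, (U.evolve ħ ψ t).pair φ = ⟪(φ : H), F b - F a⟫_ℂ := by
  rw [inner_sub_right]
  exact intervalIntegral.integral_eq_sub_of_hasDerivAt (fun t _ => hF.hasDerivAt φ t)
    ((continuous_evolve_pair ψ φ).intervalIntegrable a b)

/-- Uniqueness comes from density of the domain. All statements about weak integrals thereby reduce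
to the curve F. -/
theorem isHistoryIntegral_iff (hF : IsHistoryCurve U ħ ψ F) (a b : ℝ) (v : H) :
    IsHistoryIntegral U ħ ψ a b v ↔ v = F b - F a := by
  constructor
  · intro h
    refine (U.dense_domain ħ).eq_of_inner_right ℂ fun φ hφ => ?_
    rw [h ⟨φ, hφ⟩, hF.integral_eq]
  · rintro rfl φ
    exact (hF.integral_eq φ a b).symm

theorem eq_of_isHistoryIntegral_evolve (hF : IsHistoryCurve U ħ ψ F) {t ε : ℝ} {v : H}
    (h : IsHistoryIntegral U ħ (U.evolve ħ ψ t) 0 ε v) : v = U.op t (F ε) := by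
  refine (U.dense_domain ħ).eq_of_inner_right ℂ fun φ hφ => ?_
  have h1 := h ⟨φ, hφ⟩
  have h2 := hF.integral_eq ⟨U.op (-t) φ, U.op_mem_domain ħ (-t) hφ⟩ 0 ε
  rw [hF.cocycle.zero, sub_zero, ← U.inner_op_right] at h2
  rw [← h2]
  refine h1.trans (intervalIntegral.integral_congr fun s _ => ?_)
  change ψ.pair ⟨U.op (-t) (U.op (-s) φ), _⟩ = ψ.pair ⟨U.op (-s) (U.op (-t) φ), _⟩
  simp only [U.op_comm (-t)]

theorem tendsto_of_distinguishable (hF : IsHistoryCurve U ħ ψ F) {t : ℝ}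
    (h : Distinguishable U ħ (U.evolve ħ ψ t) (U.evolve ħ ψ 0)) :
    Tendsto (fun ε : ℝ => ⟪U.op t (F ε), F ε⟫_ℂ / (ε : ℂ) ^ 2) (𝓝[>] 0) (𝓝 0) := by
  obtain ⟨x, y, hxy, hlim⟩ := h
  refine hlim.congr' ?_
  filter_upwards [self_mem_nhdsWithin] with ε hε
  obtain ⟨hx, hy⟩ := hxy ε hε
  rw [hF.eq_of_isHistoryIntegral_evolve hx, hF.eq_of_isHistoryIntegral_evolve hy, U.op_zero,
    inner_smul_left, inner_smul_right, map_inv₀, Complex.conj_ofReal]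
  field_simp

theorem tendsto_of_neg (hF : IsHistoryCurve U ħ ψ F)
    (h : (∀ t < 0, Distinguishable U ħ (U.evolve ħ ψ t) (U.evolve ħ ψ 0)) ∨
      (∀ t > 0, Distinguishable U ħ (U.evolve ħ ψ t) (U.evolve ħ ψ 0))) (t : ℝ) (ht : t < 0) :
    Tendsto (fun ε : ℝ => ⟪U.op t (F ε), F ε⟫_ℂ / (ε : ℂ) ^ 2) (𝓝[>] 0) (𝓝 0) := by
  rcases h with h | h
  · exact hF.tendsto_of_distinguishable (h t ht)
  · have h1 := (Complex.continuous_conj.tendsto _).comp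
      (hF.tendsto_of_distinguishable (h (-t) (by linarith)))
    rw [map_zero] at h1
    refine h1.congr fun ε => ?_
    simp only [Function.comp_apply]
    rw [map_div₀, map_pow, Complex.conj_ofReal, inner_conj_symm, ← U.inner_op_left]

theorem historySpace_eq (hF : IsHistoryCurve U ħ ψ F) :
    historySpace U ħ ψ = (Submodule.span ℂ (Set.range F)).topologicalClosure := by
  unfold historySpace
  congr 1
  refine le_antisymm (Submodule.span_le.2 ?_) (Submodule.span_mono ?_)
  · rintro v ⟨a, b, h⟩
    rw [(hF.isHistoryIntegral_iff a b v).1 h]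
    exact Submodule.sub_mem _ (Submodule.subset_span ⟨b, rfl⟩) (Submodule.subset_span ⟨a, rfl⟩)
  · rintro _ ⟨t, rfl⟩
    exact ⟨0, t, (hF.isHistoryIntegral_iff 0 t _).2 (by rw [hF.cocycle.zero, sub_zero])⟩

theorem mem_historySpace (hF : IsHistoryCurve U ħ ψ F) (t : ℝ) : F t ∈ historySpace U ħ ψ := by
  rw [hF.historySpace_eq]
  exact Submodule.le_topologicalClosure _ (Submodule.subset_span ⟨t, rfl⟩)

theorem op_mem_historySpace (hF : IsHistoryCurve U ħ ψ F) (t : ℝ) (x : H)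
    (hx : x ∈ historySpace U ħ ψ) : U.op t x ∈ historySpace U ħ ψ := by
  have hle : Submodule.span ℂ (Set.range F) ≤
      (historySpace U ħ ψ).comap (U.op t).toLinearEquiv.toLinearMap := by
    rw [Submodule.span_le]
    rintro _ ⟨s, rfl⟩
    change U.op t (F s) ∈ historySpace U ħ ψ
    rw [hF.cocycle.op_apply]
    exact Submodule.sub_mem _ (hF.mem_historySpace _) (hF.mem_historySpace _)
  have hcl : IsClosed (historySpace U ħ ψ : Set H) := Submodule.isClosed_topologicalClosure _
  rw [hF.historySpace_eq] at hx
  exact Submodule.topologicalClosure_minimal _ hle (hcl.preimage (U.op t).continuous) hx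

theorem eq_zero_of_inner (hF : IsHistoryCurve U ħ ψ F) (w : historySpace U ħ ψ)
    (hw : ∀ t, ⟪F t, (w : H)⟫_ℂ = 0) : w = 0 := by
  have h1 : (w : H) ∈ (Submodule.span ℂ (Set.range F))ᗮ := by
    rw [Submodule.mem_orthogonal]
    intro u hu
    induction hu using Submodule.span_induction with
    | mem x hx => obtain ⟨t, rfl⟩ := hx; exact hw t
    | zero => exact inner_zero_left _
    | add x y _ _ hx hy => rw [inner_add_left, hx, hy, add_zero]
    | smul c x _ hx => rw [inner_smul_left, hx, mul_zero]
  have h2 : (w : H) ∈ (Submodule.span ℂ (Set.range F)).topologicalClosure := by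
    rw [← hF.historySpace_eq]
    exact w.2
  rw [← Submodule.orthogonal_closure] at h1
  ext
  exact inner_self_eq_zero.1 ((Submodule.mem_orthogonal _ _).1 h1 _ h2)

theorem exists_inner_eq (hF : IsHistoryCurve U ħ ψ F) (hψ : ψ.pair ≠ 0)
    (h : (∀ t < 0, Distinguishable U ħ (U.evolve ħ ψ t) (U.evolve ħ ψ 0)) ∨
      (∀ t > 0, Distinguishable U ħ (U.evolve ħ ψ t) (U.evolve ħ ψ 0))) :
    ∃ c : ℝ, 0 < c ∧
      ∀ s t, ⟪(c : ℂ) • F s, (c : ℂ) • F t⟫_ℂ = ⟪step s, step t⟫_ℂ := by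
  obtain ⟨k, hk, hin⟩ := hF.cocycle.exists_inner_eq (hF.tendsto_of_neg h)
  -- If k were 0, F would vanish identically, and so would its weak derivative ψ at time 0.
  have hk0 : k ≠ 0 := by
    rintro rfl
    have hF0 : ∀ t, F t = 0 := fun t => inner_self_eq_zero.1 (by rw [hin, Complex.ofReal_zero,
      zero_mul])
    refine hψ (LinearMap.ext fun φ => ?_)
    have h1 := hF.hasDerivAt φ 0
    simp only [hF0, inner_zero_right, evolve_zero_pair] at h1
    exact h1.unique (hasDerivAt_const _ _)
  have hkpos : 0 < k := lt_of_le_of_ne hk (Ne.symm hk0)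
  refine ⟨(√k)⁻¹, by positivity, fun s t => ?_⟩
  rw [inner_smul_left, inner_smul_right, hin, inner_step_step, Complex.conj_ofReal, ← mul_assoc,
    ← mul_assoc, ← Complex.ofReal_mul, ← Complex.ofReal_mul]
  have : (√k)⁻¹ * (√k)⁻¹ * k = 1 := by
    rw [← mul_inv, Real.mul_self_sqrt hk, inv_mul_cancel₀ hk0]
  rw [this, Complex.ofReal_one, one_mul]

end IsHistoryCurve

theorem norm_linearCombination_eq {ι K L : Type*} [NormedAddCommGroup K] [InnerProductSpace ℂ K]
    [NormedAddCommGroup L] [InnerProductSpace ℂ L] {v : ι → K} {w : ι → L}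
    (h : ∀ i j, ⟪v i, v j⟫_ℂ = ⟪w i, w j⟫_ℂ) (x : ι →₀ ℂ) :
    ‖Finsupp.linearCombination ℂ v x‖ = ‖Finsupp.linearCombination ℂ w x‖ := by
  have h1 : ⟪Finsupp.linearCombination ℂ v x, Finsupp.linearCombination ℂ v x⟫_ℂ =
      ⟪Finsupp.linearCombination ℂ w x, Finsupp.linearCombination ℂ w x⟫_ℂ := by
    simp only [Finsupp.linearCombination_apply, Finsupp.sum, sum_inner, inner_sum, inner_smul_left,
      inner_smul_right, h]
  rw [norm_eq_sqrt_re_inner (𝕜 := ℂ), h1, ← norm_eq_sqrt_re_inner]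

/-- Equal Gram matrices make the correspondence of finite combinations well defined and isometric;
both families have dense span, so it extends to a unitary map. Intertwining is checked on steps,
where it is the cocycle law on both sides. -/
theorem IsHistoryCurve.exists_unitary (hF : IsHistoryCurve U ħ ψ F) {c : ℝ} (hc : 0 < c)
    (h : ∀ s t, ⟪(c : ℂ) • F s, (c : ℂ) • F t⟫_ℂ = ⟪step s, step t⟫_ℂ) :
    ∃ J : L2 ≃ₗᵢ[ℂ] historySpace U ħ ψ, (∀ t, (J (step t) : H) = (c : ℂ) • F t) ∧
      ∀ t f, (J (translate t f) : H) = U.op t (J f) := by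
  let e : (ℝ →₀ ℂ) →ₗ[ℂ] historySpace U ħ ψ :=
    Finsupp.linearCombination ℂ fun t => (c : ℂ) • ⟨F t, hF.mem_historySpace t⟩
  have hdense : DenseRange e := by
    rw [DenseRange, ← LinearMap.coe_range, Submodule.dense_iff_topologicalClosure_eq_top,
      Submodule.topologicalClosure_eq_top_iff, Submodule.eq_bot_iff]
    intro w hw
    refine hF.eq_zero_of_inner w fun t => ?_
    have h1 := (Submodule.mem_orthogonal _ _).1 hw _ ⟨Finsupp.single t 1, rfl⟩
    rw [Finsupp.linearCombination_single, one_smul] at h1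
    have h2 : ⟪(c : ℂ) • F t, (w : H)⟫_ℂ = 0 := h1
    rw [inner_smul_left, mul_eq_zero, Complex.conj_ofReal] at h2
    exact h2.resolve_left (by exact_mod_cast hc.ne')
  have hnorm : ∀ x, ‖e (LinearEquiv.refl ℂ _ x)‖ = ‖Finsupp.linearCombination ℂ step x‖ :=
    fun x => norm_linearCombination_eq (w := step)
      (v := fun t => (c : ℂ) • (⟨F t, hF.mem_historySpace t⟩ : historySpace U ħ ψ))
      (fun s t => h s t) x
  let J := (LinearEquiv.refl ℂ (ℝ →₀ ℂ)).extendOfIsometry (Finsupp.linearCombination ℂ step) e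
    denseRange_linearCombination_step hdense hnorm
  have hJ : ∀ x, J (Finsupp.linearCombination ℂ step x) = e x := fun x =>
    LinearEquiv.extendOfIsometry_eq _ _ _ denseRange_linearCombination_step hdense hnorm x
  have hstep : ∀ t, (J (step t) : H) = (c : ℂ) • F t := by
    intro t
    have := hJ (Finsupp.single t 1)
    simp only [Finsupp.linearCombination_single, one_smul, e] at this
    rw [this]
    rfl
  refine ⟨J, hstep, fun t f => ?_⟩
  have heq : (fun f => (J (translate t f) : H)) = fun f => U.op t (J f) := by
    refine denseRange_linearCombination_step.equalizer
      (continuous_subtype_val.comp (J.continuous.comp (translate t).continuous))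
      ((U.op t).continuous.comp (continuous_subtype_val.comp J.continuous)) ?_
    funext x
    simp only [Function.comp_apply]
    induction x using Finsupp.induction_linear with
    | zero => simp
    | add x y hx hy => simp only [map_add, Submodule.coe_add, hx, hy]
    | single s a =>
      simp only [Finsupp.linearCombination_single, map_smul, Submodule.coe_smul, translate_step,
        map_sub, Submodule.coe_sub, hstep, hF.cocycle.op_apply, smul_sub]
  exact congrFun heq f

end HistorySpace

/-! ### The time operator and canonical conjugacy -/

section Representation

variable {H : Type*} [NormedAddCommGroup H] [InnerProductSpace ℂ H] {ħ : ℝ} {U : UnitaryGroup H}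
  {V : Submodule ℂ H}

/-- Pulling U back along J yields a unitary group that acts by translations, so strong continuity of
translations is inherited from U. -/
theorem represents_translation (hħ : ħ ≠ 0) (hV : ∀ t, ∀ x ∈ V, U.op t x ∈ V)
    (J : L2 ≃ₗᵢ[ℂ] V) (hJ : ∀ t f, (J (translate t f) : H) = U.op t (J f)) :
    Represents J.symm (restrictTo (U.hamiltonian ħ) V) (translationHamiltonian ħ) := by
  have hop : ∀ t f, ((U.restrict hV).pullback J).op t f = translate t f := by
    intro t f
    rw [UnitaryGroup.pullback_op, J.symm_apply_eq]
    ext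
    rw [UnitaryGroup.coe_restrict_op, hJ]
  intro x y
  rw [← hamiltonian_eq_translationHamiltonian hħ _ hop,
    UnitaryGroup.represents_pullback hħ J, ← UnitaryGroup.hamiltonian_restrict hħ U hV,
    J.apply_symm_apply, J.apply_symm_apply]

/-- The time operator: multiplication by `τ` in the representation `W`. -/
def timeOperator (ħ : ℝ) (W : V ≃ₗᵢ[ℂ] L2) : V →ₗ.[ℂ] V :=
  ((phaseGroup ħ).pullback W).hamiltonian ħ

theorem represents_timeOperator (hħ : ħ ≠ 0) (W : V ≃ₗᵢ[ℂ] L2) :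
    Represents W (timeOperator ħ W) positionOperator := by
  rw [← hamiltonian_phaseGroup hħ]
  exact UnitaryGroup.represents_pullback hħ W (phaseGroup ħ)

theorem isCanonicalConjugate_timeOperator [CompleteSpace V] (hħ : ħ ≠ 0)
    (hV : ∀ t, ∀ x ∈ V, U.op t x ∈ V)
    (J : L2 ≃ₗᵢ[ℂ] V) (hJ : ∀ t f, (J (translate t f) : H) = U.op t (J f)) :
    IsCanonicalConjugate ħ (timeOperator ħ J.symm) (restrictTo (U.hamiltonian ħ) V) := by
  have hA := represents_translation hħ hV J hJ
  have hT := represents_timeOperator hħ J.symm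
  have hJA : ∀ f g, (f, g) ∈ translationGraph ħ →
      (J f, J g) ∈ (restrictTo (U.hamiltonian ħ) V).graph := by
    intro f g h
    rw [hA, translationHamiltonian_graph, J.symm_apply_apply, J.symm_apply_apply]
    exact h
  have hJT : ∀ f g, (f, g) ∈ positionGraph → (J f, J g) ∈ (timeOperator ħ J.symm).graph := by
    intro f g h
    rw [hT, positionOperator_graph, J.symm_apply_apply, J.symm_apply_apply]
    exact h
  refine ⟨UnitaryGroup.isSelfAdjoint_hamiltonian _ hħ, ?_, ?_, ?_, ?_⟩
  · rw [← UnitaryGroup.hamiltonian_restrict hħ U hV]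
    exact UnitaryGroup.isSelfAdjoint_hamiltonian _ hħ
  -- Smooth compactly supported functions are dense and stable under both operators, so both
  -- products are defined on them.
  · refine (dense_isTest.preimage J.symm.toHomeomorph.isOpenMap).mono ?_
    intro x hx
    have hx' : IsTest (J.symm x) := hx
    obtain ⟨p, hp, hfp⟩ := hx'.exists_position
    obtain ⟨g, hg, hfg⟩ := hx'.exists_translation ħ
    obtain ⟨q, -, hgq⟩ := hg.exists_position
    obtain ⟨h, -, hph⟩ := hp.exists_translation ħ
    have h1 := hJT _ _ hfp
    have h2 := hJA _ _ hfg
    rw [J.apply_symm_apply] at h1 h2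
    exact ⟨J p, J g, J q, J h, h1, h2, hJT _ _ hgq, hJA _ _ hph⟩
  · intro x Tx Ax TAx ATx h1 h2 h3 h4
    rw [hT, positionOperator_graph] at h1 h3
    rw [hA, translationHamiltonian_graph] at h2 h4
    have h5 := commutator_position_translation h1 h2 h3 h4
    rw [← map_sub, ← map_smul] at h5
    exact J.symm.injective h5
  · refine ⟨(phaseGroup ħ).pullback J.symm, U.restrict hV, rfl,
      UnitaryGroup.hamiltonian_restrict hħ U hV, fun α t x => ?_⟩
    have hR : ∀ y : V, (U.restrict hV).op t y = J (translate t (J.symm y)) := by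
      intro y
      ext
      rw [UnitaryGroup.coe_restrict_op, hJ, J.apply_symm_apply]
    simp only [UnitaryGroup.pullback_op, hR, LinearIsometryEquiv.symm_symm, J.symm_apply_apply,
      phaseGroup_op]
    rw [mulPhase_translate, map_smul]

end Representation

/-! ### Wave functions and generalized eigenvectors -/

section HistoryRepresentation

variable {H : Type*} [NormedAddCommGroup H] [InnerProductSpace ℂ H] [CompleteSpace H]
  {ħ : ℝ} {U : UnitaryGroup H} {ψ : GeneralizedVector (U.hamiltonian ħ)} {F : ℝ → H}

/-- The function representing a vector of the history space consists of its components along the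
states `ψ(τ)`. -/
theorem IsHistoryCurve.representation_ae_eq (hF : IsHistoryCurve U ħ ψ F) {c : ℝ}
    (J : L2 ≃ₗᵢ[ℂ] historySpace U ħ ψ) (hJ : ∀ t, (J (step t) : H) = (c : ℂ) • F t)
    (φ : historySpace U ħ ψ) (hφ : (φ : H) ∈ (U.hamiltonian ħ).domain) :
    ∀ᵐ τ : ℝ, J.symm φ τ = (c : ℂ) * star ((U.evolve ħ ψ τ).pair ⟨φ, hφ⟩) := by
  have hcont : Continuous fun τ : ℝ => (c : ℂ) * star ((U.evolve ħ ψ τ).pair ⟨φ, hφ⟩) :=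
    continuous_const.mul (continuous_evolve_pair ψ ⟨φ, hφ⟩).star
  have hloc := locallyIntegrable_coeFn (J.symm φ)
  -- Both sides have the same primitive: pairing with `step t` integrates the wave function over the
  -- interval from 0 to t, and pairing with F(t) integrates ⟨φ|ψ(τ)⟩.
  have h0 := ae_eq_zero_of_intervalIntegral_eq_zero (hloc.sub hcont.locallyIntegrable) fun t => by
    have h1 : ∫ τ in (0 : ℝ)..t, J.symm φ τ = (c : ℂ) * starRingEnd ℂ ⟪(φ : H), F t⟫_ℂ := by
      rw [← inner_step_left, ← J.inner_map_map, J.apply_symm_apply, Submodule.coe_inner, hJ,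
        inner_smul_left, Complex.conj_ofReal, inner_conj_symm]
    have h2 : ∫ τ in (0 : ℝ)..t, (c : ℂ) * star ((U.evolve ħ ψ τ).pair ⟨φ, hφ⟩) =
        (c : ℂ) * starRingEnd ℂ ⟪(φ : H), F t⟫_ℂ := by
      have h3 := hF.integral_eq ⟨φ, hφ⟩ 0 t
      rw [hF.cocycle.zero, sub_zero] at h3
      rw [intervalIntegral.integral_const_mul, ← h3, intervalIntegral, intervalIntegral, map_sub,
        ← integral_conj, ← integral_conj]
      rfl
    have hi : IntervalIntegrable (J.symm φ : ℝ → ℂ) volume 0 t :=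
      (hloc.integrableOn_isCompact isCompact_uIcc).intervalIntegrable
    simp only [Pi.sub_apply]
    rw [intervalIntegral.integral_sub hi (hcont.intervalIntegrable 0 t), h1, h2, sub_self]
  filter_upwards [h0] with τ hτ
  exact sub_eq_zero.1 hτ

theorem IsHistoryCurve.isGeneralizedEigenvector (hF : IsHistoryCurve U ħ ψ F) (hħ : ħ ≠ 0) {c : ℝ}
    (hc : 0 < c) (J : L2 ≃ₗᵢ[ℂ] historySpace U ħ ψ)
    (hJ : ∀ t, (J (step t) : H) = (c : ℂ) • F t)
    (hJU : ∀ t f, (J (translate t f) : H) = U.op t (J f)) (τ : ℝ) :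
    IsGeneralizedEigenvector (timeOperator ħ J.symm) (U.evolve ħ ψ τ) τ := by
  have hc0 : (c : ℂ) ≠ 0 := by exact_mod_cast hc.ne'
  have hA := represents_translation hħ hF.op_mem_historySpace J hJU
  have hT := represents_timeOperator hħ J.symm
  have hdom : ∀ f, IsTest f → (J f : H) ∈ (U.hamiltonian ħ).domain := by
    intro f hf
    obtain ⟨g, -, hfg⟩ := hf.exists_translation ħ
    have h1 : (J f, J g) ∈ (restrictTo (U.hamiltonian ħ) (historySpace U ħ ψ)).graph := by
      rw [hA, translationHamiltonian_graph, J.symm_apply_apply, J.symm_apply_apply]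
      exact hfg
    exact LinearPMap.mem_domain_of_mem_graph ((mem_graph_restrictTo _ _ _ _).1 h1)
  constructor
  -- A bump function equal to 1 at τ serves as wave function; if its pairing with ψ(τ) vanished,
  -- continuity would force the value 0 there.
  · let η : ContDiffBump τ := default
    obtain ⟨f, hf, hfη⟩ := exists_isTest_coeFn (g := fun x => (η x : ℂ))
      (η.hasCompactSupport.comp_left (g := Complex.ofReal) Complex.ofReal_zero)
      (Complex.ofRealCLM.contDiff.comp η.contDiff)
    obtain ⟨p, hp, hfp⟩ := hf.exists_position
    refine ⟨J f, J p, ?_, hdom f hf, hdom p hp, fun h0 => ?_⟩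
    · rw [hT, positionOperator_graph, J.symm_apply_apply, J.symm_apply_apply]
      exact hfp
    have h1 := hF.representation_ae_eq J hJ (J f) (hdom f hf)
    rw [J.symm_apply_apply] at h1
    have h2 : (fun x => (η x : ℂ)) =
        fun x => (c : ℂ) * star ((U.evolve ħ ψ x).pair ⟨J f, hdom f hf⟩) := by
      refine (Continuous.ae_eq_iff_eq volume (Complex.continuous_ofReal.comp η.continuous)
        (continuous_const.mul (continuous_evolve_pair ψ _).star)).1 ?_
      filter_upwards [h1, hfη] with x e1 e2
      exact e2.symm.trans e1
    have h3 := congrFun h2 τ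
    simp only [h0, star_zero, mul_zero] at h3
    rw [η.one_of_mem_closedBall (Metric.mem_closedBall_self η.rIn_pos.le)] at h3
    exact one_ne_zero (Complex.ofReal_eq_zero.1 h3)
  · intro φ Tφ hφT hφ hTφ
    have h1 := hF.representation_ae_eq J hJ φ hφ
    have h2 := hF.representation_ae_eq J hJ Tφ hTφ
    rw [hT, positionOperator_graph] at hφT
    have h3 : ∀ᵐ x : ℝ, J.symm Tφ x = (x : ℂ) * J.symm φ x := hφT
    -- Both sides are continuous in x, so the almost-everywhere identity given by multiplication by
    -- x holds at every point, in particular at τ.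
    have h4 : (fun x => (U.evolve ħ ψ x).pair ⟨Tφ, hTφ⟩) =
        fun x : ℝ => (x : ℂ) * (U.evolve ħ ψ x).pair ⟨φ, hφ⟩ := by
      refine (Continuous.ae_eq_iff_eq volume (continuous_evolve_pair ψ _)
        (Complex.continuous_ofReal.mul (continuous_evolve_pair ψ _))).1 ?_
      filter_upwards [h1, h2, h3] with x e1 e2 e3
      rw [e1, e2] at e3
      apply star_injective
      change _ = star ((x : ℂ) * (U.evolve ħ ψ x).pair ⟨φ, hφ⟩)
      rw [star_mul', Complex.star_def, Complex.conj_ofReal]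
      refine mul_left_cancel₀ hc0 ?_
      rw [Complex.star_def] at e3
      linear_combination e3
    exact congrFun h4 τ

end HistoryRepresentation

end TimeOp

end

theorem corollary1 {H : Type*} [NormedAddCommGroup H] [InnerProductSpace ℂ H] [CompleteSpace H]
    (ħ : ℝ) (hħ : 0 < ħ) (U : TimeOp.UnitaryGroup H)
    (ψ : TimeOp.GeneralizedVector (U.hamiltonian ħ)) (hψ : ψ.pair ≠ 0)
    (hdist : (∀ t < 0, TimeOp.Distinguishable U ħ (U.evolve ħ ψ t) (U.evolve ħ ψ 0)) ∨
      (∀ t > 0, TimeOp.Distinguishable U ħ (U.evolve ħ ψ t) (U.evolve ħ ψ 0))) :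
    (∀ t, ∀ x ∈ TimeOp.historySpace U ħ ψ, U.op t x ∈ TimeOp.historySpace U ħ ψ) ∧
    (∀ x : (U.hamiltonian ħ).domain, (x : H) ∈ TimeOp.historySpace U ħ ψ →
      U.hamiltonian ħ x ∈ TimeOp.historySpace U ħ ψ) ∧
    ∃ (W : TimeOp.historySpace U ħ ψ ≃ₗᵢ[ℂ] TimeOp.L2)
      (T : TimeOp.historySpace U ħ ψ →ₗ.[ℂ] TimeOp.historySpace U ħ ψ) (c : ℝ),
      0 < c ∧
      -- `W` is the representation of a vector by its components along the states `ψ(τ)`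
      (∀ (φ : TimeOp.historySpace U ħ ψ) (hφ : (φ : H) ∈ (U.hamiltonian ħ).domain),
        ∀ᵐ τ : ℝ, W φ τ = (c : ℂ) * star ((U.evolve ħ ψ τ).pair ⟨φ, hφ⟩)) ∧
      TimeOp.Represents W (TimeOp.restrictTo (U.hamiltonian ħ) (TimeOp.historySpace U ħ ψ))
        (TimeOp.translationHamiltonian ħ) ∧
      TimeOp.Represents W T TimeOp.positionOperator ∧
      TimeOp.IsCanonicalConjugate ħ T
        (TimeOp.restrictTo (U.hamiltonian ħ) (TimeOp.historySpace U ħ ψ)) ∧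
      ∀ τ : ℝ, TimeOp.IsGeneralizedEigenvector T (U.evolve ħ ψ τ) τ := by
  have hħ0 : ħ ≠ 0 := hħ.ne'
  obtain ⟨F, hcoc, hder⟩ := TimeOp.exists_cocycle hħ0 ψ
  have hF : TimeOp.IsHistoryCurve U ħ ψ F := ⟨hcoc, hder⟩
  obtain ⟨c, hc, hin⟩ := hF.exists_inner_eq hψ hdist
  obtain ⟨J, hJ, hJU⟩ := hF.exists_unitary hc hin
  have hV := hF.op_mem_historySpace
  exact ⟨hV, U.hamiltonian_mem_of_isClosed hħ0 hV (Submodule.isClosed_topologicalClosure _),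
    J.symm, TimeOp.timeOperator ħ J.symm, c, hc, hF.representation_ae_eq J hJ,
    TimeOp.represents_translation hħ0 hV J hJU, TimeOp.represents_timeOperator hħ0 J.symm,
    TimeOp.isCanonicalConjugate_timeOperator hħ0 hV J hJU,
    hF.isGeneralizedEigenvector hħ0 hc J hJ hJU⟩
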